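/- Let $C$ be an algebraically closed field of characteristic zero, let $R$ be a $C$-algebra with a fixed isomorphism $R\simeq C[[t]]$, and write $A((x))=A[[x]][x^{-1}]$ and $\vartheta=x\frac{d}{dx}$ for $A\in\{C,R\}$. Fix a set $\tau\subset C$ of representatives of $C/\mathbb Z$ with $\tau\cap\mathbb Z=\{0\}$. A connection over $A((x))$ is a finite $A((x))$-module $E$ with an $A$-linear map $\nabla:E\to E$ such that $\nabla(fe)=\vartheta(f)e+f\nabla(e)$. It is regular singular if $E$ is generated over $A((x))$ by a finitely generated $\nabla$-stable $A[[x]]$-submodule $\mathcal E$ (a logarithmic model). For $A=C$, a logarithmic model $\mathcal E$ is a Deligne–Manin lattice if all eigenvalues of the map induced by $\nabla$ on $\mathcal E/x\mathcal E$ lie in $\tau$. For $f\in A((x))$ let $E_f$ be the submodule generated by $\ker(\nabla-f)^q$ for $q$ large. The connection admits a TLJ-form over $A((x))$ if $E=\bigoplus_{i=1}^n E_{f_i}$ for some $f_1,\dots,f_n\in A((x))$ with distinct classes modulo $\mathbb Z+xA[[x]]$, and each $E_{f_i}$ has an $A((x))$-basis in which $\nabla$ has a matrix $\mathrm J^\flat(f_i)$;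 here $\mathrm J^\flat(f)$ stands for any matrix with all diagonal entries $f$, with entries in $\{0,1\}$ just below the diagonal, and with all other entries $0$. A connection $\nabla^{\rm rs}$ on $E$ is called the regular singular part of $(E,\nabla)$ if, with $P=\nabla-\nabla^{\rm rs}$: (i) $(E,\nabla^{\rm rs})$ is regular singular and admits a TLJ-form over $A((x))$; (ii) $P$ is diagonalizable over $A((x))$ with eigenvalues in $x^{-1}A[x^{-1}]$; (iii) there are $c_1,\dots,c_n\in A$ with distinct classes in $A/\mathbb Z$ such that $E=\bigoplus_i E_i$, where $E_i$ is generated by $\ker(\nabla^{\rm rs}-c_i)^q$ for $q$ large, $P(E_i)\subset E_i$, and $E_i$ has an $A((x))$-basis in which $\nabla^{\rm rs}$ has a matrix $\mathrm J^\flat(c_i)$ and $\nabla$ has the matrix $\mathrm{diag}(\mathrm J^\flat(c_i+p_1),\dots,\mathrm J^\flat(c_i+p_k))$ with $p_1,\dots,p_k\in x^{-1}A[x^{-1}]$, the off-diagonal entries of the two matrices being the same. Theorem. Let $(E,\nabla)$ be a connection over $R((x))$ without $R$-torsion which admits a TLJ-form over $R((x))$. For $\ell\ge0$ let $(E,\nabla)|_\ell$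 be its reduction $E|_\ell=E/t^{\ell+1}E$ with the induced map, viewed as a connection over $C((x))$. Then $(E,\nabla)$ has a unique regular singular part $\nabla^{\rm rs}$; each $(E,\nabla)|_\ell$ has a unique regular singular part $\nabla|_\ell^{\rm rs}$; and each $(E|_\ell,\nabla|_\ell^{\rm rs})$ contains a unique Deligne–Manin lattice $\mathcal E_\ell\subset E|_\ell$. The lattices $\mathcal E_\ell$ are stable under $R$, and $E|_{\ell+1}\to E|_\ell$ maps $\mathcal E_{\ell+1}$ onto $\mathcal E_\ell$. Put $\mathcal E=\varprojlim_\ell\mathcal E_\ell$ and $\dot E=\mathcal E[x^{-1}]$. The maps $\nabla|_\ell^{\rm rs}$ induce a connection $\dot\nabla$ over $R((x))$ on $\dot E$, and $$(E,\nabla^{\rm rs})\simeq(\dot E,\dot\nabla)$$ as connections over $R((x))$. -/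

import Mathlib

open scoped LaurentSeries

namespace FormalConnection

noncomputable section

/-- The derivation `ϑ = x d/dx` of `A((x))`: `∑ aₙ xⁿ ↦ ∑ n aₙ xⁿ`. -/
def theta {A : Type*} [CommRing A] (f : A⸨X⸩) : A⸨X⸩ where
  coeff n := (n : A) * f.coeff n
  isPWO_support' := f.isPWO_support.mono fun n hn h0 => hn (by
    have h1 : f.coeff n = 0 := h0
    show (n : A) * f.coeff n = 0
    rw [h1, mul_zero])

/-- A connection on an `A((x))`-module `E`: an additive map satisfying the Leibniz rule for `ϑ`.
As `ϑ` kills the constants, such a map is automatically `A`-linear (`Connection.map_const_smul`).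
The modules that occur are finite; finiteness is a hypothesis where it is needed. -/
@[ext]
structure Connection (A : Type*) [CommRing A] (E : Type*) [AddCommGroup E] [Module A⸨X⸩ E] where
  /-- the underlying additive map -/
  toAddHom : E →+ E
  leibniz : ∀ (f : A⸨X⸩) (e : E), toAddHom (f • e) = theta f • e + f • toAddHom e

instance {A : Type*} [CommRing A] {E : Type*} [AddCommGroup E] [Module A⸨X⸩ E] :
    CoeFun (Connection A E) (fun _ => E → E) := ⟨fun D => D.toAddHom⟩

theorem theta_C {A : Type*} [CommRing A] (a : A) :
    theta (HahnSeries.C a : A⸨X⸩) = 0 := by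
  ext n
  show (n : A) * (HahnSeries.C a : A⸨X⸩).coeff n = 0
  by_cases h : n = 0
  · simp [h]
  · simp [HahnSeries.C_apply, HahnSeries.coeff_single_of_ne h]

theorem Connection.map_const_smul {A : Type*} [CommRing A] {E : Type*} [AddCommGroup E]
    [Module A⸨X⸩ E] (D : Connection A E) (a : A) (e : E) :
    D ((HahnSeries.C a : A⸨X⸩) • e) = (HahnSeries.C a : A⸨X⸩) • D e := by
  rw [D.leibniz, theta_C, zero_smul, zero_add]

/-- Isomorphism of connections: a horizontal `A((x))`-linear isomorphism. -/
def Connection.IsIsomorphic {A : Type*} [CommRing A]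
    {E : Type*} [AddCommGroup E] [Module A⸨X⸩ E] {E' : Type*} [AddCommGroup E'] [Module A⸨X⸩ E']
    (D : Connection A E) (D' : Connection A E') : Prop :=
  ∃ ψ : E ≃ₗ[A⸨X⸩] E', ∀ e : E, ψ (D e) = D' (ψ e)

/-- The subring `A[[x]]` of `A((x))`. -/
def powerSeriesSubring (A : Type*) [CommRing A] : Subring A⸨X⸩ :=
  (HahnSeries.ofPowerSeries ℤ A).range

/-- The element `x` of `A((x))`. -/
def xVar (A : Type*) [CommRing A] : A⸨X⸩ := HahnSeries.single 1 1

/-- `ℒ ⊆ E` is a logarithmic model of `(E, D)`: a finitely generated `A[[x]]`-submodule which is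
stable under `D` and generates `E` over `A((x))`. -/
structure IsLogModel {A : Type*} [CommRing A] {E : Type*} [AddCommGroup E] [Module A⸨X⸩ E]
    (D : Connection A E) (L : Submodule (powerSeriesSubring A) E) : Prop where
  fg : L.FG
  span_eq_top : Submodule.span A⸨X⸩ (L : Set E) = ⊤
  stable : ∀ v ∈ L, D v ∈ L

/-- `(E, D)` is regular singular: it comes from a logarithmic connection over `A[[x]]`. (The image
in `E` of any logarithmic connection `ℰ` with `ℰ[x⁻¹] ≅ E` is a logarithmic model inside `E`.) -/
def IsRegularSingular {A : Type*} [CommRing A] {E : Type*} [AddCommGroup E] [Module A⸨X⸩ E]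
    (D : Connection A E) : Prop :=
  ∃ L : Submodule (powerSeriesSubring A) E, IsLogModel D L

/-- `c` is an exponent of the logarithmic model `L` over a field: an eigenvalue of the residue,
that is, of the `K`-linear endomorphism of `L / xL` induced by `D`. The vector `v` represents an
eigenvector: its class in `L / xL` is nonzero, and the residue multiplies this class by `c`. -/
def IsExponent {K : Type*} [Field K] {M : Type*} [AddCommGroup M] [Module K⸨X⸩ M]
    (D : Connection K M) (L : Submodule (powerSeriesSubring K) M) (c : K) : Prop :=
  ∃ v ∈ L, (¬ ∃ w ∈ L, v = xVar K • w) ∧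
    ∃ w ∈ L, D v - (HahnSeries.C c : K⸨X⸩) • v = xVar K • w

/-- Deligne-Manin lattice with respect to `τ`: a logarithmic model all of whose exponents lie in
`τ`. (Over a field a finitely generated `K[[x]]`-submodule of `M` is torsion-free, so free.) -/
structure IsDeligneManinLattice {K : Type*} [Field K] {M : Type*} [AddCommGroup M] [Module K⸨X⸩ M]
    (τ : Set K) (D : Connection K M) (L : Submodule (powerSeriesSubring K) M) : Prop where
  isLogModel : IsLogModel D L
  exponents : ∀ c : K, IsExponent D L c → c ∈ τ

/-- `dLog = ℤ + xA[[x]]`. The characters are the classes in `A((x))/dLog = A[x⁻¹]/ℤ`. -/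
def IsDLog {A : Type*} [CommRing A] (f : A⸨X⸩) : Prop :=
  (∀ n : ℤ, n < 0 → f.coeff n = 0) ∧ ∃ k : ℤ, f.coeff 0 = (k : A)

/-- `f ∈ x⁻¹A[x⁻¹]`. -/
def IsPolar {A : Type*} [CommRing A] (f : A⸨X⸩) : Prop :=
  ∀ n : ℤ, 0 ≤ n → f.coeff n = 0

/-- The sub-`A((x))`-module of `E` generated by `ker (D - f)^q` for `q` large enough. -/
def isotypical {A : Type*} [CommRing A] {E : Type*} [AddCommGroup E] [Module A⸨X⸩ E]
    (D : Connection A E) (f : A⸨X⸩) : Submodule A⸨X⸩ E :=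
  Submodule.span A⸨X⸩ {e : E | ∃ q : ℕ, (fun v : E => D v - f • v)^[q] e = 0}

/-- The lower bidiagonal matrix with diagonal `d` and with the entry `1` at `(j+1, j)` if `δ j`
holds, `0` otherwise. With constant `d = f` these are the matrices `J♭_r(f)`. -/
def bidiagonal {K : Type*} [Zero K] [One K] {r : ℕ} (d : Fin r → K) (δ : Fin r → Bool) :
    Matrix (Fin r) (Fin r) K :=
  Matrix.of fun i j =>
    if i = j then d i else if (i : ℕ) = (j : ℕ) + 1 ∧ δ j = true then 1 else 0

/-- `M` is the matrix of `D` on the submodule `W` in the basis `b`: `D bⱼ = ∑ᵢ Mᵢⱼ bᵢ`. -/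
def HasMatrix {A : Type*} [CommRing A] {E : Type*} [AddCommGroup E] [Module A⸨X⸩ E]
    (D : Connection A E) {W : Submodule A⸨X⸩ E} {r : ℕ} (b : Module.Basis (Fin r) A⸨X⸩ W)
    (M : Matrix (Fin r) (Fin r) A⸨X⸩) : Prop :=
  ∀ j : Fin r, D (b j : E) = ∑ i : Fin r, M i j • (b i : E)

/-- TLJ-decomposition over `A((x))` with the distinct characters `[f₁], …, [fₙ]`: the module is the
direct sum of the isotypical components of these types. -/
structure IsTLJDecomposition {A : Type*} [CommRing A] {E : Type*} [AddCommGroup E] [Module A⸨X⸩ E]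
    (D : Connection A E) {n : ℕ} (f : Fin n → A⸨X⸩) : Prop where
  distinct : ∀ i j : Fin n, i ≠ j → ¬ IsDLog (f i - f j)
  isInternal : DirectSum.IsInternal (fun i : Fin n => isotypical D (f i))

/-- `(E, D)` admits a Turrittin-Levelt-Jordan form over `A((x))`: it has a TLJ-decomposition, and
each component has a basis in which the matrix of `D` is some `J♭_r(f)`, with `f` a representative
of the character. -/
def HasTLJForm {A : Type*} [CommRing A] {E : Type*} [AddCommGroup E] [Module A⸨X⸩ E]
    (D : Connection A E) : Prop :=
  ∃ (n : ℕ) (f : Fin n → A⸨X⸩), IsTLJDecomposition D f ∧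
    ∀ i : Fin n, ∃ (r : ℕ) (b : Module.Basis (Fin r) A⸨X⸩ (isotypical D (f i)))
      (δ : Fin r → Bool), HasMatrix D b (bidiagonal (fun _ => f i) δ)

/-- `D = D' + P` is the (unramified) logarithmic decomposition, so that `D'` is the regular singular
part of `D`. This is used over `R((x))` for connections with a TLJ-form over `R((x))`, and over
`C((x))` for their reductions, which have Turrittin index one.
`P = D - D'` is `A((x))`-linear since `D` and `D'` satisfy the same Leibniz rule. -/
structure IsRegularSingularPart {A : Type*} [CommRing A]
    {E : Type*} [AddCommGroup E] [Module A⸨X⸩ E] (D D' : Connection A E) : Prop where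
  regularSingular : IsRegularSingular D'
  hasTLJForm : HasTLJForm D'
  /-- `P` is diagonalizable with eigenvalues in `x⁻¹A[x⁻¹]`. -/
  diagonalizable : ∃ (m : ℕ) (b : Module.Basis (Fin m) A⸨X⸩ E) (p : Fin m → A⸨X⸩),
    ∀ j : Fin m, IsPolar (p j) ∧ D (b j) - D' (b j) = p j • b j
  /-- `D'` has a TLJ-decomposition with characters `[cᵢ] ∈ A/ℤ`; `P` preserves its components; and
  each component has a basis in which `D'` has a matrix `J♭(cᵢ)` and `D` has the matrix
  `diag(J♭(cᵢ + p₁), …, J♭(cᵢ + p_k))` with the same off-diagonal entries, so that `P` is diagonal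
  in this basis. The last clause is the block structure: no entry `1` connects two different
  values of `p`. -/
  jordan : ∃ (n : ℕ) (c : Fin n → A),
    IsTLJDecomposition D' (fun i => (HahnSeries.C (c i) : A⸨X⸩)) ∧
    ∀ i : Fin n,
      (∀ v ∈ isotypical D' (HahnSeries.C (c i) : A⸨X⸩),
        D v - D' v ∈ isotypical D' (HahnSeries.C (c i) : A⸨X⸩)) ∧
      ∃ (r : ℕ) (b : Module.Basis (Fin r) A⸨X⸩ (isotypical D' (HahnSeries.C (c i) : A⸨X⸩)))
        (δ : Fin r → Bool) (p : Fin r → A⸨X⸩),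
        (∀ j, IsPolar (p j)) ∧
        HasMatrix D' b (bidiagonal (fun _ => (HahnSeries.C (c i) : A⸨X⸩)) δ) ∧
        HasMatrix D b (bidiagonal (fun j => (HahnSeries.C (c i) : A⸨X⸩) + p j) δ) ∧
        ∀ j k : Fin r, (k : ℕ) = (j : ℕ) + 1 → δ j = true → p j = p k

/-- The inclusion `C((x)) → R((x))` induced by `C → R`. -/
def coeffMap (C R : Type*) [CommRing C] [CommRing R] [Algebra C R] : C⸨X⸩ →+* R⸨X⸩ where
  toFun f := HahnSeries.map f (algebraMap C R)
  map_one' := by ext n; simp [HahnSeries.coeff_one, apply_ite (algebraMap C R)]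
  map_mul' _ _ := HahnSeries.map_mul (algebraMap C R : C →ₙ+* R)
  map_zero' := by ext; simp
  map_add' x y := by ext; simp

theorem theta_coeffMap {C R : Type*} [CommRing C] [CommRing R] [Algebra C R] (f : C⸨X⸩) :
    theta (coeffMap C R f) = coeffMap C R (theta f) := by
  ext n
  show (n : R) * algebraMap C R (f.coeff n) = algebraMap C R ((n : C) * f.coeff n)
  simp

/-- The submodule `t^{ℓ+1} E`. -/
def tPowSubmodule {R : Type*} [CommRing R] (t : R) (E : Type*) [AddCommGroup E] [Module R⸨X⸩ E]
    (l : ℕ) : Submodule R⸨X⸩ E :=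
  LinearMap.range (LinearMap.lsmul R⸨X⸩ E (HahnSeries.C (t ^ (l + 1))))

/-- The reduction `E|_ℓ = E / t^{ℓ+1} E`. -/
def Reduction {R : Type*} [CommRing R] (t : R) (E : Type*) [AddCommGroup E] [Module R⸨X⸩ E]
    (l : ℕ) : Type _ := E ⧸ tPowSubmodule t E l

section Reduction

variable {C R : Type*} [CommRing C] [CommRing R] [Algebra C R] {t : R}
  {E : Type*} [AddCommGroup E] [Module R⸨X⸩ E] {l : ℕ}

instance : AddCommGroup (Reduction t E l) :=
  inferInstanceAs (AddCommGroup (E ⧸ tPowSubmodule t E l))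

/-- `E|_ℓ` is regarded as a `C((x))`-module through `C((x)) → R((x))`. This instance stands before
the next one, which therefore takes precedence for `R((x))` itself. -/
instance instModuleConst : Module C⸨X⸩ (Reduction t E l) :=
  Module.compHom (E ⧸ tPowSubmodule t E l) (coeffMap C R)

instance instModuleReduction : Module R⸨X⸩ (Reduction t E l) :=
  inferInstanceAs (Module R⸨X⸩ (E ⧸ tPowSubmodule t E l))

end Reduction

/-- The projection `E → E|_ℓ`. -/
def Reduction.mk {R : Type*} [CommRing R] (t : R) (E : Type*) [AddCommGroup E] [Module R⸨X⸩ E]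
    (l : ℕ) : E →ₗ[R⸨X⸩] Reduction t E l :=
  (tPowSubmodule t E l).mkQ

theorem tPowSubmodule_le {R : Type*} [CommRing R] (t : R) (E : Type*) [AddCommGroup E]
    [Module R⸨X⸩ E] (l : ℕ) : tPowSubmodule t E (l + 1) ≤ tPowSubmodule t E l := by
  rintro _ ⟨e, rfl⟩
  refine ⟨(HahnSeries.C t : R⸨X⸩) • e, ?_⟩
  simp only [LinearMap.lsmul_apply, smul_smul, ← map_mul]
  rw [← pow_succ]

/-- The transition map `E|_{ℓ+1} → E|_ℓ`. -/
def Reduction.transition {R : Type*} [CommRing R] (t : R) (E : Type*) [AddCommGroup E]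
    [Module R⸨X⸩ E] (l : ℕ) : Reduction t E (l + 1) →ₗ[R⸨X⸩] Reduction t E l :=
  Submodule.factor (tPowSubmodule_le t E l)

theorem Reduction.const_smul_mk {C R : Type*} [CommRing C] [CommRing R] [Algebra C R] {t : R}
    {E : Type*} [AddCommGroup E] [Module R⸨X⸩ E] {l : ℕ} (f : C⸨X⸩) (e : E) :
    f • Reduction.mk t E l e = Reduction.mk t E l (coeffMap C R f • e) := rfl

/-- The reduction `D|_ℓ` of a connection over `R((x))`, as a connection over `C((x))`. -/
def Connection.reduce (C : Type*) {R : Type*} [CommRing C] [CommRing R] [Algebra C R]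
    {E : Type*} [AddCommGroup E] [Module R⸨X⸩ E] (D : Connection R E) (t : R) (l : ℕ) :
    Connection C (Reduction t E l) where
  toAddHom := QuotientAddGroup.map (tPowSubmodule t E l).toAddSubgroup
    (tPowSubmodule t E l).toAddSubgroup D.toAddHom (by
      rintro _ ⟨e, rfl⟩
      exact ⟨D e, (D.map_const_smul _ e).symm⟩)
  leibniz f e := by
    obtain ⟨e, rfl⟩ := Submodule.mkQ_surjective (tPowSubmodule t E l) e
    show Reduction.mk t E l (D (coeffMap C R f • e)) =
      Reduction.mk t E l (coeffMap C R (theta f) • e) +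
        Reduction.mk t E l (coeffMap C R f • D e)
    rw [D.leibniz, theta_coeffMap, map_add]

theorem Connection.reduce_mk {C R : Type*} [CommRing C] [CommRing R] [Algebra C R]
    {E : Type*} [AddCommGroup E] [Module R⸨X⸩ E] (D : Connection R E) (t : R) (l : ℕ) (e : E) :
    D.reduce C t l (Reduction.mk t E l e) = Reduction.mk t E l (D e) := rfl

/-- The limit `ℰ = lim ℒ_ℓ` of lattices `ℒ_ℓ ⊆ E|_ℓ`, realised as the set of the families
`(v_ℓ) ∈ ∏ ℒ_ℓ` which are compatible with the transition maps. -/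
def limitLattice {C R : Type*} [CommRing C] [CommRing R] [Algebra C R] {t : R}
    {E : Type*} [AddCommGroup E] [Module R⸨X⸩ E]
    (L : ∀ l : ℕ, Submodule (powerSeriesSubring C) (Reduction t E l)) :
    Set (∀ l : ℕ, Reduction t E l) :=
  {v | ∀ l : ℕ, v l ∈ L l ∧ Reduction.transition t E l (v (l + 1)) = v l}

/-- The `R((x))`-module `ℰ[x⁻¹]` for `ℰ = lim ℒ_ℓ`. As `x` is invertible on `∏ E|_ℓ`, this is the
`R((x))`-submodule of `∏ E|_ℓ` generated by `ℰ` (for lattices stable under `R`). -/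
def limitModule {C R : Type*} [CommRing C] [CommRing R] [Algebra C R] {t : R}
    {E : Type*} [AddCommGroup E] [Module R⸨X⸩ E]
    (L : ∀ l : ℕ, Submodule (powerSeriesSubring C) (Reduction t E l)) :
    Submodule R⸨X⸩ (∀ l : ℕ, Reduction t E l) :=
  Submodule.span R⸨X⸩ (limitLattice L)

end

end FormalConnection

open FormalConnection

/-! Everything is computed in a basis of Jordan strings. Over `R((x))` a diagonal change of basis
turns each `fᵢ` of the TLJ-form into `cᵢ + pᵢ`, with `pᵢ` polar and `cᵢ ∈ R` reducing into `τ`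
modulo `t` (`HasTLJForm.exists_chain_basis`): the part of positive degree is removed by solving `ϑu
= hu`, and integers are shifted by powers of `x`. Then `∇ʳˢ = ∇ - diag(pᵢ)`. Uniqueness holds over
any domain: `ϑφ + (c + p)φ = 0` has no nonzero solution when `p ≠ 0` is polar, so the change of
basis between two decompositions respects the polar eigenvalues (`IsRegularSingularPart.unique`).

The difficulty is that reduction does not commute with taking regular singular parts. Over `C((x))`,
multiplication by `pᵢ` modulo `t^{ℓ+1}` is its reduction `p₀ᵢ` modulo `t` plus a nilpotent map, so
only `p₀ᵢ` may be subtracted. The two candidates differ by the gauge transformation `exp ∫ (p₀ᵢ -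
pᵢ) dx/x`, a finite sum modulo `t^{ℓ+1}` because `p₀ᵢ - pᵢ` is divisible by `t`
(`exists_truncated_exp`). Composed with the projections, these gauges give maps `φ_ℓ : E → E|_ℓ`
which are compatible, have kernel `t^{ℓ+1}E`, and carry `∇ʳˢ` to `∇|_ℓʳˢ`. Their pole orders may
grow with `ℓ`, so they need not converge over `R((x))`; this is why `E` and `Ė` are identified
through the `φ_ℓ` and not through the projections.

On `E|_ℓ` each string over `R` yields a finite-dimensional `C`-space on which `∇|_ℓʳˢ` is a scalar
in `τ` plus a nilpotent map. Jordan normal form gives a basis over `C((x))` whose `C[[x]]`-span is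
the only Deligne–Manin lattice (`IsDeligneManinLattice.eq_span`). This lattice is also the image
under `φ_ℓ` of the `R[[x]]`-span of the strings in `E`
(`IsReductionMap.regularSingularPart_and_lattice`), which gives stability under `R` and surjectivity
of the transitions. Since `R[[x]]` is `t`-adically complete and separated, the `φ_ℓ` together form
an isomorphism `E ≃ Ė` (`exists_equiv_limitModule`). -/

namespace FormalConnection

noncomputable section

/-! ### Laurent series: the derivation, powers of `x`, and scalar equations of first order -/

section Series

variable {A : Type*} [CommRing A]

theorem coeff_theta (f : A⸨X⸩) (n : ℤ) : (theta f).coeff n = (n : A) * f.coeff n := rfl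

theorem theta_add (f g : A⸨X⸩) : theta (f + g) = theta f + theta g := by
  ext n
  simp only [coeff_theta, HahnSeries.coeff_add, mul_add]

theorem support_theta_subset (f : A⸨X⸩) : (theta f).support ⊆ f.support := fun n hn h0 => hn (by
  have h1 : f.coeff n = 0 := h0
  show (theta f).coeff n = 0
  rw [coeff_theta, h1, mul_zero])

theorem theta_mul (f g : A⸨X⸩) : theta (f * g) = f * theta g + g * theta f := by
  ext n
  rw [mul_comm g, HahnSeries.coeff_add, coeff_theta, HahnSeries.coeff_mul,
    HahnSeries.coeff_mul_left' f.isPWO_support (support_theta_subset f),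
    HahnSeries.coeff_mul_right' g.isPWO_support (support_theta_subset g), Finset.mul_sum,
    ← Finset.sum_add_distrib]
  refine Finset.sum_congr rfl fun ij hij => ?_
  have h : ij.1 + ij.2 = n := (Finset.mem_antidiagonal.1 hij).2.2
  rw [coeff_theta, coeff_theta, ← h]
  push_cast
  ring

theorem theta_C_mul (a : A) (f : A⸨X⸩) :
    theta (HahnSeries.C a * f) = HahnSeries.C a * theta f := by
  rw [theta_mul, theta_C, mul_zero, add_zero]

theorem theta_single (n : ℤ) (a : A) :
    theta (HahnSeries.single n a : A⸨X⸩) = HahnSeries.C (n : A) * HahnSeries.single n a := by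
  ext m
  rw [coeff_theta, HahnSeries.C_mul_eq_smul, HahnSeries.coeff_smul, smul_eq_mul]
  by_cases h : m = n
  · rw [h]
  · simp [HahnSeries.coeff_single_of_ne h]

theorem theta_pow_succ (f : A⸨X⸩) (k : ℕ) :
    theta (f ^ (k + 1)) = HahnSeries.C ((k : A) + 1) * (f ^ k * theta f) := by
  induction k with
  | zero => simp
  | succ k ih =>
    rw [pow_succ, theta_mul, ih]
    simp only [map_add, map_one, map_natCast]
    push_cast
    ring

theorem coeff_C_mul (a : A) (f : A⸨X⸩) (n : ℤ) :
    (HahnSeries.C a * f).coeff n = a * f.coeff n := by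
  rw [HahnSeries.C_mul_eq_smul, HahnSeries.coeff_smul, smul_eq_mul]

theorem mem_powerSeriesSubring_iff {f : A⸨X⸩} :
    f ∈ powerSeriesSubring A ↔ ∀ n : ℤ, n < 0 → f.coeff n = 0 := by
  constructor
  · rintro ⟨g, rfl⟩ n hn
    have := PowerSeries.coeff_coe g n
    rw [if_pos hn] at this
    exact this
  · intro h
    refine ⟨PowerSeries.mk fun n => f.coeff n, ?_⟩
    ext n
    have := PowerSeries.coeff_coe (PowerSeries.mk fun n => f.coeff n) n
    refine Eq.trans this ?_
    split_ifs with hn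
    · exact (h n hn).symm
    · rw [PowerSeries.coeff_mk]
      congr 1
      omega

theorem theta_mem_powerSeriesSubring {f : A⸨X⸩} (hf : f ∈ powerSeriesSubring A) :
    theta f ∈ powerSeriesSubring A := by
  rw [mem_powerSeriesSubring_iff] at hf ⊢
  intro n hn
  rw [coeff_theta, hf n hn, mul_zero]

theorem C_mem_powerSeriesSubring (a : A) : (HahnSeries.C a : A⸨X⸩) ∈ powerSeriesSubring A := by
  rw [mem_powerSeriesSubring_iff]
  intro n hn
  exact HahnSeries.coeff_single_of_ne hn.ne

/-- A power of `x`, as a unit of `A((x))`. -/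
def xPow (A : Type*) [CommRing A] (n : ℤ) : A⸨X⸩ˣ where
  val := HahnSeries.single n 1
  inv := HahnSeries.single (-n) 1
  val_inv := by simp
  inv_val := by simp

theorem xPow_coe (n : ℤ) : (xPow A n : A⸨X⸩) = HahnSeries.single n 1 := rfl

theorem xPow_zero : (xPow A 0 : A⸨X⸩) = 1 := rfl

theorem xVar_mul_xPow (n : ℤ) : xVar A * (xPow A n : A⸨X⸩) = xPow A (n + 1) := by
  simp [xVar, xPow_coe, add_comm]

theorem xPow_mul_xPow (m n : ℤ) : (xPow A m : A⸨X⸩) * xPow A n = xPow A (m + n) := by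
  simp [xPow_coe]

theorem coeff_xPow_mul (m n : ℤ) (f : A⸨X⸩) :
    ((xPow A m : A⸨X⸩) * f).coeff n = f.coeff (n - m) := by
  simp [xPow_coe, HahnSeries.coeff_single_mul]

theorem theta_xPow (n : ℤ) : theta (xPow A n : A⸨X⸩) = HahnSeries.C (n : A) * (xPow A n : A⸨X⸩) :=
  theta_single n 1

theorem xPow_mem_powerSeriesSubring {n : ℤ} (hn : 0 ≤ n) :
    (xPow A n : A⸨X⸩) ∈ powerSeriesSubring A := by
  rw [mem_powerSeriesSubring_iff]
  intro m hm
  exact HahnSeries.coeff_single_of_ne (by omega)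

theorem exists_xPow_mul_mem (f : A⸨X⸩) :
    ∃ n : ℕ, ∀ m : ℕ, n ≤ m → (xPow A m : A⸨X⸩) * f ∈ powerSeriesSubring A := by
  refine ⟨(-f.order).toNat, fun m hm => ?_⟩
  rw [mem_powerSeriesSubring_iff]
  intro k hk
  rw [coeff_xPow_mul]
  exact HahnSeries.coeff_eq_zero_of_lt_order (by omega)

theorem isDLog_C_sub_C {a b : A} :
    IsDLog (HahnSeries.C a - HahnSeries.C b : A⸨X⸩) ↔ ∃ k : ℤ, a - b = (k : A) := by
  constructor
  · rintro ⟨-, k, hk⟩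
    exact ⟨k, by simpa using hk⟩
  · rintro ⟨k, hk⟩
    refine ⟨fun n hn => ?_, k, by simpa using hk⟩
    rw [← map_sub]
    exact HahnSeries.coeff_single_of_ne hn.ne

theorem IsPolar.sub {f g : A⸨X⸩} (hf : IsPolar f) (hg : IsPolar g) : IsPolar (f - g) := by
  intro n hn
  rw [HahnSeries.coeff_sub, hf n hn, hg n hn, sub_zero]

/-- Coefficientwise the equation reads `(n + c) φₙ = 0`, and `n + c` is never zero. It separates
constants that differ by a non-integer. -/
theorem eq_zero_of_theta_add_C_mul [IsDomain A] {φ : A⸨X⸩} {c : A}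
    (h : theta φ + HahnSeries.C c * φ = 0) (hc : ∀ n : ℤ, c ≠ (n : A)) : φ = 0 := by
  ext n
  have h1 := congrArg (fun f : A⸨X⸩ => f.coeff n) h
  simp only [HahnSeries.coeff_add, coeff_theta, coeff_C_mul, HahnSeries.coeff_zero] at h1
  rw [← add_mul] at h1
  refine (mul_eq_zero.1 h1).resolve_left fun h2 => hc (-n) ?_
  push_cast
  linear_combination h2

/-- In degree `ord p + ord φ < ord φ` only `pφ` contributes, with the product of two nonzero leading
coefficients. It separates distinct polar parts. -/
theorem eq_zero_of_theta_add_polar_mul [IsDomain A] {φ p : A⸨X⸩} {c : A} (hp : IsPolar p)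
    (hp0 : p ≠ 0) (h : theta φ + (HahnSeries.C c + p) * φ = 0) : φ = 0 := by
  by_contra hφ
  have hneg : p.order < 0 := by
    by_contra hlt
    exact hp0 (HahnSeries.coeff_order_eq_zero.1 (hp _ (not_lt.1 hlt)))
  have h1 := congrArg (fun f : A⸨X⸩ => f.coeff (p.order + φ.order)) h
  have h2 : φ.coeff (p.order + φ.order) = 0 :=
    HahnSeries.coeff_eq_zero_of_lt_order (by omega)
  simp only [add_mul, HahnSeries.coeff_add, coeff_theta, coeff_C_mul, HahnSeries.coeff_zero, h2,
    mul_zero, zero_add, HahnSeries.coeff_mul_order_add_order] at h1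
  exact (mul_ne_zero (HahnSeries.leadingCoeff_ne_zero.2 hp0)
    (HahnSeries.leadingCoeff_ne_zero.2 hφ)) h1

theorem C_dvd_of_dvd_coeff {a : A} {f : A⸨X⸩} (h : ∀ n, a ∣ f.coeff n) :
    (HahnSeries.C a : A⸨X⸩) ∣ f := by
  classical
  choose g hg using h
  -- The chosen quotients are reset to zero where `f` vanishes, so that the support stays partially
  -- well-ordered.
  refine ⟨⟨fun n => if f.coeff n = 0 then 0 else g n,
    f.isPWO_support.mono fun n hn h0 => hn ?_⟩, ?_⟩
  · exact if_pos h0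
  · ext n
    rw [coeff_C_mul]
    show _ = a * (if f.coeff n = 0 then 0 else g n)
    split_ifs with h0
    · rw [h0, mul_zero]
    · exact hg n

theorem C_dvd_iff {a : A} {f : A⸨X⸩} : (HahnSeries.C a : A⸨X⸩) ∣ f ↔ ∀ n, a ∣ f.coeff n := by
  refine ⟨?_, C_dvd_of_dvd_coeff⟩
  rintro ⟨g, rfl⟩ n
  rw [coeff_C_mul]
  exact dvd_mul_right _ _

/-- The coefficients of the solution of `ϑ u = h u` with constant term `1`, where `h` has
coefficients `h n` for `n > 0`. -/
def expCoeff [Algebra ℚ A] (h : ℤ → A) : ℕ → A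
  | 0 => 1
  | n + 1 => algebraMap ℚ A (1 / (n + 1)) * ∑ k : Fin (n + 1), h (n + 1 - k) * expCoeff h k

/-- As `h` starts in degree one, the coefficient of `xⁿ` gives `n uₙ = ∑_{k<n} h_{n-k} u_k`, a
recursion solvable over `ℚ`. The constant term `1` makes the solution a unit. -/
theorem exists_theta_eq_mul [Algebra ℚ A] (h : A⸨X⸩) (hh : ∀ n : ℤ, n ≤ 0 → h.coeff n = 0) :
    ∃ u : A⸨X⸩ˣ, theta (u : A⸨X⸩) = h * u := by
  set v : PowerSeries A := PowerSeries.mk (expCoeff fun n => h.coeff n) with hv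
  have hvu : IsUnit v := by
    rw [PowerSeries.isUnit_iff_constantCoeff, ← PowerSeries.coeff_zero_eq_constantCoeff_apply, hv,
      PowerSeries.coeff_mk, expCoeff]
    exact isUnit_one
  set w : PowerSeries A := PowerSeries.mk fun n => h.coeff n with hw
  have hwh : HahnSeries.ofPowerSeries ℤ A w = h := by
    ext n
    refine (PowerSeries.coeff_coe w n).trans ?_
    split_ifs with hn
    · exact (hh n hn.le).symm
    · rw [hw, PowerSeries.coeff_mk]
      congr 1
      omega
  refine ⟨(hvu.map (HahnSeries.ofPowerSeries ℤ A)).unit, ?_⟩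
  show theta (HahnSeries.ofPowerSeries ℤ A v) = h * HahnSeries.ofPowerSeries ℤ A v
  conv_rhs => rw [← hwh, ← map_mul, mul_comm w v]
  ext n
  rw [coeff_theta]
  refine (congrArg _ (PowerSeries.coeff_coe v n)).trans
    (Eq.trans ?_ (PowerSeries.coeff_coe (v * w) n).symm)
  split_ifs with hn
  · rw [mul_zero]
  · obtain ⟨m, rfl⟩ := Int.eq_ofNat_of_zero_le (not_lt.1 hn)
    simp only [Int.natAbs_natCast]
    rw [PowerSeries.coeff_mul, Finset.Nat.sum_antidiagonal_eq_sum_range_succ_mk]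
    cases m with
    | zero =>
      simp [hw, hh 0 le_rfl]
    | succ m =>
      have h1 : (((m + 1 : ℕ) : ℤ) : A) * algebraMap ℚ A (1 / (m + 1)) = 1 := by
        have : (((m + 1 : ℕ) : ℤ) : A) = algebraMap ℚ A (m + 1) := by simp
        rw [this, ← map_mul, mul_one_div_cancel (by positivity), map_one]
      rw [Finset.sum_range_succ, hv, PowerSeries.coeff_mk, expCoeff, ← mul_assoc, h1, one_mul,
        Fin.sum_univ_eq_sum_range
          (fun k => h.coeff ((m : ℤ) + 1 - k) * expCoeff (fun n => h.coeff n) k)]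
      simp only [Nat.sub_self, hw, PowerSeries.coeff_mk, Nat.cast_zero, hh 0 le_rfl, mul_zero,
        add_zero]
      refine Finset.sum_congr rfl fun k hk => ?_
      have hk' := Finset.mem_range.1 hk
      have h3 : ((m + 1 - k : ℕ) : ℤ) = (m : ℤ) + 1 - k := by omega
      rw [h3, mul_comm]

end Series

/-! ### Connections with a triangular matrix -/

section Triangular

variable {A : Type*} [CommRing A] {E : Type*} [AddCommGroup E] [Module A⸨X⸩ E]

theorem Connection.ext_basis {ι : Type*} [Fintype ι] (b : Module.Basis ι A⸨X⸩ E)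
    {D D' : Connection A E} (h : ∀ j, D (b j) = D' (b j)) : D = D' := by
  ext v
  rw [← b.sum_repr v, map_sum, map_sum]
  exact Finset.sum_congr rfl fun j _ => by rw [D.leibniz, D'.leibniz, h]

/-- The connection `D - P` for an `A((x))`-linear map `P`. -/
def Connection.subLinear (D : Connection A E) (P : E →ₗ[A⸨X⸩] E) : Connection A E where
  toAddHom := D.toAddHom - P.toAddMonoidHom
  leibniz f e := by
    show D (f • e) - P (f • e) = theta f • e + f • (D e - P e)
    rw [D.leibniz, map_smul, smul_sub, add_sub_assoc]

theorem Connection.subLinear_apply (D : Connection A E) (P : E →ₗ[A⸨X⸩] E) (e : E) :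
    D.subLinear P e = D e - P e := rfl

/-- In the basis `b`, the connection `D` has the matrix with diagonal `d` plus the constant
matrix `N`. -/
def HasTriangularMatrix (D : Connection A E) {ι : Type*} [Fintype ι] (b : Module.Basis ι A⸨X⸩ E)
    (d : ι → A⸨X⸩) (N : ι → ι → A) : Prop :=
  ∀ j, D (b j) = d j • b j + ∑ i, (HahnSeries.C (N i j) : A⸨X⸩) • b i

variable {ι : Type*} [Fintype ι] {D : Connection A E} {b : Module.Basis ι A⸨X⸩ E}
  {d : ι → A⸨X⸩} {N : ι → ι → A}

theorem HasTriangularMatrix.repr_apply (h : HasTriangularMatrix D b d N) (v : E) (i : ι) :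
    b.repr (D v) i = theta (b.repr v i) + d i * b.repr v i
      + ∑ j, HahnSeries.C (N i j) * b.repr v j := by
  classical
  have h1 : D v = ∑ j, (theta (b.repr v j) • b j + b.repr v j • D (b j)) := by
    conv_lhs => rw [← b.sum_repr v, map_sum]
    exact Finset.sum_congr rfl fun j _ => D.leibniz _ _
  have h2 : D v = ∑ i, (theta (b.repr v i) + d i * b.repr v i
      + ∑ j, HahnSeries.C (N i j) * b.repr v j) • b i := by
    rw [h1]
    simp only [h _, smul_add, add_smul, Finset.sum_add_distrib, Finset.smul_sum, Finset.sum_smul,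
      smul_smul]
    rw [Finset.sum_comm, ← add_assoc]
    simp only [mul_comm]
  rw [h2]
  exact congrFun (b.repr_sum_self _) i

/-- Induction from the ends of the strings backwards: off the diagonal, a connection moves basis
vectors to greater height, and the index set is finite. -/
theorem induction_of_lt_height {ι : Type*} [Finite ι] (ht : ι → ℕ) {P : ι → Prop}
    (h : ∀ j, (∀ i, ht j < ht i → P i) → P j) (j : ι) : P j := by
  let r : ι → ι → Prop := fun i j => ht j < ht i
  have : IsTrans ι r := ⟨fun _ _ _ h1 h2 => lt_trans h2 h1⟩
  have : Std.Irrefl r := ⟨fun _ => lt_irrefl _⟩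
  exact (Finite.wellFounded_of_trans_of_irrefl r).induction j h

/-- If `Z` is an additive group of series such that `θ φ + (dᵢ - s) φ ∈ Z` implies `φ ∈ Z`, then
the coordinates of `v` are in `Z` as soon as those of `(D - s) v` are. -/
theorem HasTriangularMatrix.repr_mem (h : HasTriangularMatrix D b d N) (ht : ι → ℕ)
    (hN : ∀ i j, N i j ≠ 0 → ht j < ht i) (Z : AddSubgroup A⸨X⸩)
    (hZ : ∀ (a : A), ∀ f ∈ Z, HahnSeries.C a * f ∈ Z) (S : Set ι)
    (hS : ∀ i j, N i j ≠ 0 → i ∈ S → j ∈ S) (s : A⸨X⸩)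
    (hs : ∀ i ∈ S, ∀ φ, theta φ + (d i - s) * φ ∈ Z → φ ∈ Z) (v : E)
    (hv : ∀ i ∈ S, b.repr (D v - s • v) i ∈ Z) : ∀ i ∈ S, b.repr v i ∈ Z := by
  intro i
  induction hi : ht i using Nat.strong_induction_on generalizing i with
  | _ n ih =>
    intro hiS
    refine hs i hiS _ ?_
    have h1 := hv i hiS
    rw [map_sub, map_smul, Finsupp.sub_apply, Finsupp.smul_apply, h.repr_apply, smul_eq_mul] at h1
    -- Coordinates entering from other basis vectors have smaller height, so they are already known
    -- to lie in `Z`; the scalar equation `hs` is left.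
    have h2 : ∑ j, HahnSeries.C (N i j) * b.repr v j ∈ Z := by
      refine Z.sum_mem fun j _ => ?_
      by_cases h0 : N i j = 0
      · rw [h0, map_zero, zero_mul]
        exact Z.zero_mem
      · exact hZ _ _ (ih _ (hi ▸ hN i j h0) j rfl (hS i j h0 hiS))
    have h3 := Z.sub_mem h1 h2
    convert h3 using 1
    ring

end Triangular

/-! ### Jordan strings and uniqueness of the regular singular part -/

section Uniqueness

variable {A : Type*} [CommRing A] {E : Type*} [AddCommGroup E] [Module A⸨X⸩ E]

/-- The basis vector of the same block which follows `x` in a union of Jordan strings. -/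
def chainNext {ι : Type*} {r : ι → ℕ} (δ : ∀ a, Fin (r a) → Bool) (x : Σ a, Fin (r a)) :
    Option (Σ a, Fin (r a)) :=
  if h : (x.2 : ℕ) + 1 < r x.1 ∧ δ x.1 x.2 = true then some ⟨x.1, ⟨(x.2 : ℕ) + 1, h.1⟩⟩ else none

open Classical in
/-- The off-diagonal part of a block diagonal matrix with blocks `bidiagonal _ (δ a)`. -/
def chainMatrix (A : Type*) [CommRing A] {ι : Type*} {r : ι → ℕ} (δ : ∀ a, Fin (r a) → Bool)
    (y x : Σ a, Fin (r a)) : A :=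
  if chainNext δ x = some y then 1 else 0

variable {ι : Type*} {r : ι → ℕ} (δ : ∀ a, Fin (r a) → Bool)

theorem chainNext_eq_some {δ : ∀ a, Fin (r a) → Bool} {x y : Σ a, Fin (r a)}
    (h : chainNext δ x = some y) : y.1 = x.1 ∧ (y.2 : ℕ) = x.2 + 1 ∧ δ x.1 x.2 = true := by
  unfold chainNext at h
  split_ifs at h with h1
  cases h
  exact ⟨rfl, rfl, h1.2⟩

theorem chainNext_of_chainMatrix_ne_zero {δ : ∀ a, Fin (r a) → Bool} {x y : Σ a, Fin (r a)}
    (h : chainMatrix A δ y x ≠ 0) : chainNext δ x = some y := by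
  by_contra h1
  exact h (if_neg h1)

theorem chainMatrix_ne_zero {δ : ∀ a, Fin (r a) → Bool} {x y : Σ a, Fin (r a)}
    (h : chainMatrix A δ y x ≠ 0) : y.1 = x.1 ∧ (x.2 : ℕ) < y.2 := by
  have := chainNext_eq_some (chainNext_of_chainMatrix_ne_zero h)
  exact ⟨this.1, by omega⟩

theorem sum_chainMatrix_smul [Fintype ι] (w : (Σ a, Fin (r a)) → E) (x : Σ a, Fin (r a)) :
    ∑ y, (HahnSeries.C (chainMatrix A δ y x) : A⸨X⸩) • w y = (chainNext δ x).elim 0 w := by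
  classical
  cases h : chainNext δ x with
  | none => simp [chainMatrix, h]
  | some z =>
    rw [Finset.sum_eq_single z]
    · simp [chainMatrix, h]
    · intro y _ hy
      simp [chainMatrix, h, Ne.symm hy]
    · simp

theorem sum_bidiagonal_smul {m : ℕ} (d : Fin m → A⸨X⸩) (ε : Fin m → Bool) (w : Fin m → E)
    (j : Fin m) : ∑ i, bidiagonal d ε i j • w i =
      d j • w j + if h : (j : ℕ) + 1 < m ∧ ε j = true then w ⟨(j : ℕ) + 1, h.1⟩ else 0 := by
  have h0 : ∀ i, bidiagonal d ε i j • w i = (if i = j then d j • w j else 0) +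
      if (i : ℕ) = (j : ℕ) + 1 ∧ ε j = true then w i else 0 := by
    intro i
    rw [bidiagonal, Matrix.of_apply]
    split_ifs with h1 h2 h2
    · subst h1; omega
    · subst h1; rw [add_zero]
    · rw [one_smul, zero_add]
    · rw [zero_smul, zero_add]
  simp only [h0, Finset.sum_add_distrib, Finset.sum_ite_eq', Finset.mem_univ, if_true]
  congr 1
  split_ifs with h
  · rw [Finset.sum_eq_single ⟨(j : ℕ) + 1, h.1⟩]
    · simp [h.2]
    · intro i _ hi
      rw [if_neg]
      rintro ⟨h1, -⟩
      exact hi (Fin.ext h1)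
    · simp
  · refine Finset.sum_eq_zero fun i _ => if_neg ?_
    rintro ⟨h1, h2⟩
    exact h ⟨h1 ▸ i.2, h2⟩

theorem hasTriangularMatrix_chainMatrix_iff [Fintype ι] {D : Connection A E}
    {b : Module.Basis (Σ a, Fin (r a)) A⸨X⸩ E} {d : (Σ a, Fin (r a)) → A⸨X⸩} :
    HasTriangularMatrix D b d (chainMatrix A δ) ↔
      ∀ a j, D (b ⟨a, j⟩) = ∑ i, bidiagonal (fun j => d ⟨a, j⟩) (δ a) i j • b ⟨a, i⟩ := by
  unfold HasTriangularMatrix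
  rw [Sigma.forall]
  refine forall_congr' fun a => forall_congr' fun j => ?_
  rw [sum_chainMatrix_smul, sum_bidiagonal_smul (fun j => d ⟨a, j⟩) (δ a) (fun i => b ⟨a, i⟩)]
  unfold chainNext
  split_ifs with h <;> rfl

theorem IsTLJDecomposition.hasTriangularMatrix {D D' : Connection A E} {n : ℕ}
    {f : Fin n → A⸨X⸩} (hD : IsTLJDecomposition D' f) {r : Fin n → ℕ}
    (b : ∀ i, Module.Basis (Fin (r i)) A⸨X⸩ (isotypical D' (f i))) {δ : ∀ i, Fin (r i) → Bool}
    {d : (Σ i, Fin (r i)) → A⸨X⸩}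
    (hb : ∀ i, HasMatrix D (b i) (bidiagonal (fun j => d ⟨i, j⟩) (δ i))) :
    HasTriangularMatrix D (hD.isInternal.collectedBasis b) d (chainMatrix A δ) := by
  rw [hasTriangularMatrix_chainMatrix_iff]
  intro a j
  simp only [DirectSum.IsInternal.collectedBasis_coe]
  exact hb a j

/-- All that uniqueness needs: one basis triangular for both connections, with the same off-diagonal
part, along which the polar part is constant. -/
theorem IsRegularSingularPart.exists_basis {D D' : Connection A E}
    (h : IsRegularSingularPart D D') :
    ∃ (κ : Type) (_ : Fintype κ) (b : Module.Basis κ A⸨X⸩ E) (c : κ → A) (p : κ → A⸨X⸩)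
      (N : κ → κ → A) (ht : κ → ℕ), (∀ j, IsPolar (p j)) ∧
      (∀ i j, N i j ≠ 0 → ht j < ht i ∧ p i = p j) ∧
      HasTriangularMatrix D' b (fun j => HahnSeries.C (c j)) N ∧
      HasTriangularMatrix D b (fun j => HahnSeries.C (c j) + p j) N := by
  obtain ⟨n, c, hdec, hj⟩ := h.jordan
  choose _ r b δ p hp hD' hD hδ using hj
  refine ⟨Σ i, Fin (r i), inferInstance, hdec.isInternal.collectedBasis b, fun x => c x.1,
    fun x => p x.1 x.2, chainMatrix A δ, fun x => x.2, fun x => hp x.1 x.2, ?_,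
    hdec.hasTriangularMatrix b hD', hdec.hasTriangularMatrix b hD⟩
  rintro ⟨a, i⟩ ⟨a', j⟩ hN
  refine ⟨(chainMatrix_ne_zero hN).2, ?_⟩
  obtain ⟨h1, h2, h3⟩ := chainNext_eq_some (chainNext_of_chainMatrix_ne_zero hN)
  simp only at h1
  subst h1
  exact (hδ a j i h2 h3).symm

/-- The polar eigenvalues are determined by `D`: a vector of the first basis with polar part `p`
only involves vectors of the second basis with the same polar part. Hence both linear parts multiply
it by `p`. -/
theorem IsRegularSingularPart.unique [IsDomain A] {D D₁ D₂ : Connection A E}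
    (h₁ : IsRegularSingularPart D D₁) (h₂ : IsRegularSingularPart D D₂) : D₁ = D₂ := by
  obtain ⟨κ₁, _, b₁, c₁, p₁, N₁, ht₁, hp₁, hN₁, hD₁, hDD₁⟩ := h₁.exists_basis
  obtain ⟨κ₂, _, b₂, c₂, p₂, N₂, ht₂, hp₂, hN₂, hD₂, hDD₂⟩ := h₂.exists_basis
  -- Induction from the ends of the first strings: `D - c₁ⱼ - p₁ⱼ` sends `b₁ j` to vectors already
  -- treated, and the indices with `p₂ k ≠ p₁ j` are closed under the second off-diagonal matrix.
  -- With `Z = 0`, each coordinate solves the polar equation with `p = p₂ k - p₁ j ≠ 0`.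
  have key : ∀ j k, p₂ k ≠ p₁ j → b₂.repr (b₁ j) k = 0 := by
    refine induction_of_lt_height ht₁ fun j ih k hk => ?_
    refine hDD₂.repr_mem ht₂ (fun i j h => (hN₂ i j h).1) ⊥ ?_ {k | p₂ k ≠ p₁ j} ?_
      (HahnSeries.C (c₁ j) + p₁ j) ?_ (b₁ j) ?_ k hk
    · intro a f hf
      rw [AddSubgroup.mem_bot.1 hf, mul_zero]
      exact AddSubgroup.zero_mem _
    · intro i i' h hi
      rw [Set.mem_ofPred_eq, ← (hN₂ i i' h).2]
      exact hi
    · intro i hi φ hφ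
      refine eq_zero_of_theta_add_polar_mul (c := c₂ i - c₁ j) ((hp₂ i).sub (hp₁ j))
        (sub_ne_zero.2 hi) ?_
      rw [← AddSubgroup.mem_bot.1 hφ, map_sub]
      ring
    · intro i hi
      rw [hDD₁ j, add_sub_cancel_left, map_sum, Finsupp.finsetSum_apply]
      refine AddSubgroup.sum_mem _ fun i' _ => ?_
      rw [map_smul, Finsupp.smul_apply]
      by_cases h0 : N₁ i' j = 0
      · rw [h0, map_zero, zero_smul]
        exact AddSubgroup.zero_mem _
      · have h1 := hN₁ i' j h0
        rw [ih i' h1.1 i (by rw [h1.2]; exact hi), smul_zero]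
        exact AddSubgroup.zero_mem _
  refine Connection.ext_basis b₁ fun j => ?_
  have e1 : D (b₁ j) - D₁ (b₁ j) = p₁ j • b₁ j := by
    rw [hD₁ j, hDD₁ j, add_smul]
    abel
  have e2 : D (b₁ j) - D₂ (b₁ j) = p₁ j • b₁ j := by
    refine b₂.ext_elem fun k => ?_
    rw [map_sub, map_smul, Finsupp.sub_apply, Finsupp.smul_apply, hD₂.repr_apply,
      hDD₂.repr_apply, smul_eq_mul]
    by_cases hk : p₂ k = p₁ j
    · rw [hk]
      ring
    · rw [key j k hk]
      ring
  rw [← sub_right_inj (a := D (b₁ j)), e1, e2]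

end Uniqueness

/-! ### A basis of Jordan strings yields a regular singular part -/

section Existence

variable {A : Type*} [CommRing A] {E : Type*} [AddCommGroup E] [Module A⸨X⸩ E]

theorem exists_iterate_chain_eq_zero {ι : Type*} [Fintype ι] {r : ι → ℕ}
    {δ : ∀ a, Fin (r a) → Bool} {D : Connection A E} {b : Module.Basis (Σ a, Fin (r a)) A⸨X⸩ E}
    {c : ι → A} (h : HasTriangularMatrix D b (fun x => HahnSeries.C (c x.1)) (chainMatrix A δ)) :
    ∀ x : Σ a, Fin (r a), ∃ q : ℕ,
      (fun v : E => D v - (HahnSeries.C (c x.1) : A⸨X⸩) • v)^[q] (b x) = 0 := by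
  refine induction_of_lt_height (fun x => x.2) fun x ih => ?_
  have h1 : D (b x) - (HahnSeries.C (c x.1) : A⸨X⸩) • b x = (chainNext δ x).elim 0 b := by
    rw [h x, sum_chainMatrix_smul, add_sub_cancel_left]
  cases hx : chainNext δ x with
  | none => exact ⟨1, h1.trans (by rw [hx]; rfl)⟩
  | some y =>
    have hy := chainNext_eq_some hx
    obtain ⟨q, hq⟩ := ih y (by omega)
    refine ⟨q + 1, ?_⟩
    rw [Function.iterate_succ_apply, h1, hx, ← hy.1]
    exact hq

/-- On strings with constant `γ` the operator `D - γ` is nilpotent on basis vectors. On every other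
string the constant differs from `γ` by a non-integer, so `D - γ` annihilates no nonzero coordinate
vector there. -/
theorem mem_isotypical_iff [IsDomain A] {ι : Type*} [Fintype ι] {r : ι → ℕ}
    {δ : ∀ a, Fin (r a) → Bool} {D : Connection A E} {b : Module.Basis (Σ a, Fin (r a)) A⸨X⸩ E}
    {c : ι → A} (h : HasTriangularMatrix D b (fun x => HahnSeries.C (c x.1)) (chainMatrix A δ))
    {γ : A} (hγ : ∀ a, (∃ k : ℤ, c a - γ = k) → c a = γ) {v : E} :
    v ∈ isotypical D (HahnSeries.C γ) ↔ ∀ x, c x.1 ≠ γ → b.repr v x = 0 := by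
  constructor
  · intro hv x hx
    refine Submodule.span_induction (p := fun v _ => b.repr v x = 0) ?_ (by simp) ?_ ?_ hv
    · rintro e ⟨q, hq⟩
      induction q generalizing e x with
      | zero =>
        rw [show e = 0 from hq, map_zero, Finsupp.zero_apply]
      | succ q ih =>
        -- Applied to the coordinates on the single string through `x`, which does not interact with
        -- the others.
        have key := h.repr_mem (fun x => x.2) (fun i j hij => (chainMatrix_ne_zero hij).2) ⊥ ?_
          {y | y.1 = x.1} ?_ (HahnSeries.C γ) ?_ e ?_ x rfl
        · exact key
        · intro a f hf
          rw [AddSubgroup.mem_bot.1 hf, mul_zero]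
          exact AddSubgroup.zero_mem _
        · intro i j hij hi
          exact (chainMatrix_ne_zero hij).1.symm.trans hi
        · intro i hi φ hφ
          have hi' : i.1 = x.1 := hi
          refine eq_zero_of_theta_add_C_mul (c := c i.1 - γ) ?_ ?_
          · rw [map_sub]
            exact AddSubgroup.mem_bot.1 hφ
          · intro n hn
            exact hx (hγ x.1 ⟨n, by rw [← hi', hn]⟩)
        · intro i hi
          have hi' : i.1 = x.1 := hi
          exact ih i (by rw [hi']; exact hx) _ hq
    · intro v w _ _ hv hw
      rw [map_add, Finsupp.add_apply, hv, hw, add_zero]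
    · intro f v _ hv
      rw [map_smul, Finsupp.smul_apply, hv, smul_zero]
  · intro hv
    rw [← b.sum_repr v]
    refine Submodule.sum_mem _ fun x _ => ?_
    by_cases hx : c x.1 = γ
    · refine Submodule.smul_mem _ _ (Submodule.subset_span ?_)
      rw [← hx]
      exact exists_iterate_chain_eq_zero h x
    · rw [hv x hx, zero_smul]
      exact Submodule.zero_mem _

theorem isInternal_of_repr {K M ι κ : Type*} [CommRing K] [AddCommGroup M] [Module K M]
    [Fintype ι] [DecidableEq κ] (b : Module.Basis ι K M) (g : ι → κ) (W : κ → Submodule K M)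
    (hW : ∀ k v, v ∈ W k ↔ ∀ x, g x ≠ k → b.repr v x = 0) : DirectSum.IsInternal W := by
  refine DirectSum.isInternal_submodule_of_iSupIndep_of_iSup_eq_top ?_ ?_
  · rw [iSupIndep_def]
    intro k
    rw [Submodule.disjoint_def]
    intro v hv hv'
    refine b.ext_elem fun x => ?_
    rw [map_zero, Finsupp.zero_apply]
    by_cases hx : g x = k
    · have : (⨆ j, ⨆ (_ : j ≠ k), W j) ≤ LinearMap.ker (b.coord x) := by
        refine iSup₂_le fun j hj w hw => ?_
        exact (hW j w).1 hw x (by rw [hx]; exact hj.symm)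
      exact this hv'
    · exact (hW k v).1 hv x hx
  · rw [eq_top_iff, ← b.span_eq, Submodule.span_le]
    rintro _ ⟨x, rfl⟩
    refine Submodule.mem_iSup_of_mem (g x) ((hW _ _).2 fun y hy => ?_)
    rw [b.repr_self, Finsupp.single_eq_of_ne]
    rintro rfl
    exact hy rfl

/-- The members of a finite disjoint union of strings can be enumerated string by string. -/
theorem exists_enumeration_chainNext {ι : Type*} [Fintype ι] {r : ι → ℕ}
    (δ : ∀ a, Fin (r a) → Bool) :
    ∃ (m : ℕ) (σ : Fin m ≃ Σ a, Fin (r a)) (ε : Fin m → Bool), ∀ s : Fin m,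
      (if h : (s : ℕ) + 1 < m ∧ ε s = true then some (σ ⟨(s : ℕ) + 1, h.1⟩) else none) =
        chainNext δ (σ s) := by
  set e := (Fintype.equivFin ι).symm
  set σ : Fin (∑ k, r (e k)) ≃ Σ a, Fin (r a) :=
    finSigmaFinEquiv.symm.trans (Equiv.sigmaCongrLeft (β := fun a => Fin (r a)) e) with hσ
  -- The flag is `false` at the end of a string, so consecutive strings in the enumeration are not
  -- linked.
  refine ⟨_, σ, fun s => (chainNext δ (σ s)).isSome, fun s => ?_⟩
  obtain ⟨⟨k, j⟩, rfl⟩ := finSigmaFinEquiv.surjective s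
  have hσ' : ∀ k j, σ (finSigmaFinEquiv ⟨k, j⟩) = ⟨e k, j⟩ := by
    intro k j
    simp [hσ]
  cases hx : chainNext δ (σ (finSigmaFinEquiv ⟨k, j⟩)) with
  | none => exact dif_neg fun h => by simp [hx] at h
  | some y =>
    rw [hσ'] at hx
    have hx' := hx
    unfold chainNext at hx
    split_ifs at hx with h1
    cases hx
    have h2 : (finSigmaFinEquiv (⟨k, ⟨(j : ℕ) + 1, h1.1⟩⟩ : Σ k, Fin (r (e k))) : ℕ) =
        (finSigmaFinEquiv (⟨k, j⟩ : Σ k, Fin (r (e k))) : ℕ) + 1 := by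
      rw [finSigmaFinEquiv_apply, finSigmaFinEquiv_apply]
      simp only
      omega
    have h3 : (finSigmaFinEquiv (⟨k, j⟩ : Σ k, Fin (r (e k))) : ℕ) + 1 < ∑ k, r (e k) := by
      rw [← h2]
      exact Fin.isLt _
    have h4 : (⟨_, h3⟩ : Fin (∑ k, r (e k))) =
      finSigmaFinEquiv (⟨k, ⟨(j : ℕ) + 1, h1.1⟩⟩ : Σ k, Fin (r (e k))) := Fin.ext h2.symm
    rw [dif_pos ⟨h3, by simp only [hσ', hx', Option.isSome_some]⟩, h4, hσ']

/-- The basis of an isotypical component given by the strings of the corresponding type. -/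
theorem exists_basis_of_chain {ι : Type*} [Fintype ι] {r : ι → ℕ} (δ : ∀ a, Fin (r a) → Bool)
    (b : Module.Basis (Σ a, Fin (r a)) A⸨X⸩ E) (S : Set ι) (W : Submodule A⸨X⸩ E)
    (hW : ∀ v, v ∈ W ↔ ∀ x, x.1 ∉ S → b.repr v x = 0) :
    ∃ (m : ℕ) (b' : Module.Basis (Fin m) A⸨X⸩ W) (ε : Fin m → Bool)
      (σ : Fin m → Σ a, Fin (r a)), (∀ s, (σ s).1 ∈ S) ∧
      (∀ s t : Fin m, (t : ℕ) = (s : ℕ) + 1 → ε s = true → (σ t).1 = (σ s).1) ∧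
      ∀ (D : Connection A E) (d : (Σ a, Fin (r a)) → A⸨X⸩),
        HasTriangularMatrix D b d (chainMatrix A δ) →
          HasMatrix D b' (bidiagonal (fun s => d (σ s)) ε) := by
  classical
  have : Fintype S := Fintype.ofFinite S
  obtain ⟨m, σ, ε, hσ⟩ := exists_enumeration_chainNext (fun a : S => δ a)
  set τ : (Σ a : S, Fin (r a)) → Σ a, Fin (r a) := fun x => ⟨x.1, x.2⟩ with hτ
  have hτi : Function.Injective τ := by
    rintro ⟨⟨a, ha⟩, i⟩ ⟨⟨a', ha'⟩, i'⟩ h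
    cases h
    rfl
  have hnext : ∀ x, chainNext δ (τ x) = (chainNext (fun a : S => δ a) x).map τ := by
    rintro ⟨a, i⟩
    unfold chainNext
    simp only [hτ]
    split_ifs <;> rfl
  have hli : LinearIndependent A⸨X⸩ (fun s => b (τ (σ s))) :=
    b.linearIndependent.comp _ (hτi.comp σ.injective)
  have hspan : Submodule.span A⸨X⸩ (Set.range fun s => b (τ (σ s))) = W := by
    apply le_antisymm
    · rw [Submodule.span_le]
      rintro _ ⟨s, rfl⟩
      refine (hW _).2 fun x hx => ?_
      rw [b.repr_self, Finsupp.single_eq_of_ne]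
      rintro rfl
      exact hx (σ s).1.2
    · intro v hv
      rw [← b.sum_repr v]
      refine Submodule.sum_mem _ fun x _ => ?_
      by_cases hx : x.1 ∈ S
      · refine Submodule.smul_mem _ _ (Submodule.subset_span ⟨σ.symm ⟨⟨x.1, hx⟩, x.2⟩, ?_⟩)
        simp only [Equiv.apply_symm_apply, hτ]
      · rw [(hW v).1 hv x hx, zero_smul]
        exact Submodule.zero_mem _
  have hb' : ∀ s, (((Module.Basis.span hli).map (LinearEquiv.ofEq _ _ hspan) s : W) : E) =
      b (τ (σ s)) := by
    intro s
    rw [Module.Basis.map_apply, LinearEquiv.coe_ofEq_apply, Module.Basis.span_apply]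
  refine ⟨m, (Module.Basis.span hli).map (LinearEquiv.ofEq _ _ hspan), ε, fun s => τ (σ s),
    fun s => (σ s).1.2, ?_, ?_⟩
  · intro s t hst hs
    have h1 := hσ s
    have h2 : (⟨(s : ℕ) + 1, hst ▸ t.2⟩ : Fin m) = t := Fin.ext hst.symm
    rw [dif_pos ⟨hst ▸ t.2, hs⟩, h2] at h1
    exact congrArg Subtype.val (chainNext_eq_some h1.symm).1
  · intro D d hD j
    rw [sum_bidiagonal_smul (fun s => d (τ (σ s))) ε
      (fun i => (((Module.Basis.span hli).map (LinearEquiv.ofEq _ _ hspan) i : W) : E))]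
    simp only [hb']
    rw [hD, sum_chainMatrix_smul, hnext, ← hσ]
    split_ifs <;> rfl

theorem isRegularSingular_of_hasTriangularMatrix {ι : Type*} [Fintype ι] {D : Connection A E}
    {b : Module.Basis ι A⸨X⸩ E} {c : ι → A} {N : ι → ι → A}
    (h : HasTriangularMatrix D b (fun i => HahnSeries.C (c i)) N) :
    IsLogModel D (Submodule.span (powerSeriesSubring A) (Set.range b)) where
  fg := Submodule.fg_span (Set.finite_range b)
  span_eq_top := by
    rw [eq_top_iff, ← b.span_eq]
    exact Submodule.span_mono Submodule.subset_span
  stable v hv := by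
    have hC : ∀ (a : A) (i : ι), (HahnSeries.C a : A⸨X⸩) • b i ∈
        Submodule.span (powerSeriesSubring A) (Set.range b) := fun a i =>
      Submodule.smul_mem _ (⟨_, C_mem_powerSeriesSubring a⟩ : powerSeriesSubring A)
        (Submodule.subset_span ⟨i, rfl⟩)
    refine Submodule.span_induction (p := fun v _ => D v ∈
      Submodule.span (powerSeriesSubring A) (Set.range b)) ?_ ?_ ?_ ?_ hv
    · rintro _ ⟨i, rfl⟩
      rw [h i]
      exact Submodule.add_mem _ (hC _ _) (Submodule.sum_mem _ fun j _ => hC _ _)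
    · rw [map_zero]
      exact Submodule.zero_mem _
    · intro v w _ _ hv hw
      rw [map_add]
      exact Submodule.add_mem _ hv hw
    · intro f v hv' hv
      have : D (f • v) = (⟨theta (f : A⸨X⸩), theta_mem_powerSeriesSubring f.2⟩ :
          powerSeriesSubring A) • v + f • D v := D.leibniz f v
      rw [this]
      exact Submodule.add_mem _ (Submodule.smul_mem _ _ hv') (Submodule.smul_mem _ _ hv)

/-- Strings with equal constants are grouped into one component. By `hc` different constants are
different modulo `ℤ`, so these groups are exactly the isotypical components. The polar part is
constant on each string, hence it is diagonal and leaves the entries `1` unchanged. -/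
theorem isRegularSingularPart_of_chain [IsDomain A] {ι : Type*} [Fintype ι] {r : ι → ℕ}
    {δ : ∀ a, Fin (r a) → Bool} {D D' : Connection A E}
    (b : Module.Basis (Σ a, Fin (r a)) A⸨X⸩ E) (c : ι → A) (p : ι → A⸨X⸩)
    (hp : ∀ a, IsPolar (p a)) (hc : ∀ a a', (∃ k : ℤ, c a - c a' = k) → c a = c a')
    (hD' : HasTriangularMatrix D' b (fun x => HahnSeries.C (c x.1)) (chainMatrix A δ))
    (hD : HasTriangularMatrix D b (fun x => HahnSeries.C (c x.1) + p x.1) (chainMatrix A δ)) :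
    IsRegularSingularPart D D' := by
  classical
  -- The characters must be listed without repetition, hence the image of `c` instead of its index
  -- set.
  set S : Finset A := Finset.univ.image c with hS
  set γ : Fin S.card → A := fun i => (S.equivFin.symm i : A) with hγ
  have hγc : ∀ i, ∃ a, c a = γ i := fun i => by
    obtain ⟨a, -, ha⟩ := Finset.mem_image.1 (S.equivFin.symm i).2
    exact ⟨a, ha⟩
  have hcγ : ∀ i a, (∃ k : ℤ, c a - γ i = k) → c a = γ i := by
    intro i a
    obtain ⟨a', ha'⟩ := hγc i
    rw [← ha']
    exact hc a a'
  set g : (Σ a, Fin (r a)) → Fin S.card := fun x =>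
    S.equivFin ⟨c x.1, Finset.mem_image_of_mem c (Finset.mem_univ _)⟩ with hg
  have hgγ : ∀ x i, g x = i ↔ c x.1 = γ i := by
    intro x i
    rw [hg, hγ]
    simp only
    rw [← Equiv.eq_symm_apply, Subtype.ext_iff]
  have hmem : ∀ i v, v ∈ isotypical D' (HahnSeries.C (γ i) : A⸨X⸩) ↔
      ∀ x, c x.1 ≠ γ i → b.repr v x = 0 := fun i v => mem_isotypical_iff hD' (hcγ i)
  have hdec : IsTLJDecomposition D' (fun i => (HahnSeries.C (γ i) : A⸨X⸩)) := by
    refine ⟨fun i j hij hlog => hij ?_, isInternal_of_repr b g _ fun i v => ?_⟩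
    · rw [isDLog_C_sub_C] at hlog
      obtain ⟨a, ha⟩ := hγc i
      have h1 : γ i = γ j := by
        rw [← ha] at hlog ⊢
        exact hcγ j a hlog
      exact S.equivFin.symm.injective (Subtype.ext h1)
    · rw [hmem]
      refine forall_congr' fun x => ?_
      rw [Ne, Ne, hgγ]
  have hbasis := fun i => exists_basis_of_chain δ b {a | c a = γ i} _ (hmem i)
  refine ⟨⟨_, isRegularSingular_of_hasTriangularMatrix hD'⟩, ⟨_, _, hdec, fun i => ?_⟩, ?_,
    ⟨_, γ, hdec, fun i => ⟨?_, ?_⟩⟩⟩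
  · obtain ⟨m, b', ε, σ, hσ, -, h⟩ := hbasis i
    refine ⟨m, b', ε, ?_⟩
    have h1 := h D' _ hD'
    have h2 : (fun s => (HahnSeries.C (c (σ s).1) : A⸨X⸩)) = fun _ => HahnSeries.C (γ i) :=
      funext fun s => congrArg _ (hσ s)
    rwa [h2] at h1
  · set e := Fintype.equivFin (Σ a, Fin (r a))
    refine ⟨_, b.reindex e, fun j => p (e.symm j).1, fun j => ⟨hp _, ?_⟩⟩
    rw [Module.Basis.reindex_apply, hD, hD', add_smul]
    abel
  · intro v hv
    rw [hmem] at hv ⊢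
    intro x hx
    rw [map_sub, Finsupp.sub_apply, hD.repr_apply, hD'.repr_apply, hv x hx]
    ring
  · obtain ⟨m, b', ε, σ, hσ, hσ', h⟩ := hbasis i
    have h2 : (fun s => (HahnSeries.C (c (σ s).1) : A⸨X⸩)) = fun _ => HahnSeries.C (γ i) :=
      funext fun s => congrArg _ (hσ s)
    have h3 : (fun s => (HahnSeries.C (c (σ s).1) : A⸨X⸩) + p (σ s).1) =
        fun s => HahnSeries.C (γ i) + p (σ s).1 :=
      funext fun s => by rw [show c (σ s).1 = γ i from hσ s]
    refine ⟨m, b', ε, fun s => p (σ s).1, fun s => hp _, h2 ▸ h D' _ hD', h3 ▸ h D _ hD, ?_⟩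
    intro s t hst hs
    simp only [hσ' s t hst hs]

end Existence

/-! ### Coefficients of coordinates and the standard lattice -/

section Lattice

variable {A : Type*} [CommRing A] {E : Type*} [AddCommGroup E] [Module A⸨X⸩ E]

/-- The series whose coefficient of index `n` vanishes. -/
def coeffKer (A : Type*) [CommRing A] (n : ℤ) : AddSubgroup A⸨X⸩ where
  carrier := {f | f.coeff n = 0}
  zero_mem' := rfl
  add_mem' {f g} hf hg := by
    show (f + g).coeff n = 0
    rw [HahnSeries.coeff_add, show f.coeff n = 0 from hf, show g.coeff n = 0 from hg, add_zero]
  neg_mem' {f} hf := by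
    show (-f).coeff n = 0
    rw [HahnSeries.coeff_neg, show f.coeff n = 0 from hf, neg_zero]

theorem mem_coeffKer {n : ℤ} {f : A⸨X⸩} : f ∈ coeffKer A n ↔ f.coeff n = 0 := Iff.rfl

theorem C_mul_mem_coeffKer {n : ℤ} (a : A) :
    ∀ f ∈ coeffKer A n, HahnSeries.C a * f ∈ coeffKer A n :=
  fun f hf => by rw [mem_coeffKer, coeff_C_mul, mem_coeffKer.1 hf, mul_zero]

theorem mem_span_powerSeriesSubring_iff {ι : Type*} [Fintype ι] (b : Module.Basis ι A⸨X⸩ E)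
    {v : E} : v ∈ Submodule.span (powerSeriesSubring A) (Set.range b) ↔
      ∀ i, ∀ n : ℤ, n < 0 → (b.repr v i).coeff n = 0 := by
  simp only [← mem_powerSeriesSubring_iff]
  constructor
  · intro hv i
    refine Submodule.span_induction (p := fun v _ => b.repr v i ∈ powerSeriesSubring A)
      ?_ ?_ ?_ ?_ hv
    · rintro _ ⟨j, rfl⟩
      classical
      rw [b.repr_self, Finsupp.single_apply]
      split_ifs
      · exact one_mem _
      · exact zero_mem _
    · rw [map_zero]
      exact zero_mem _
    · intro v w _ _ hv hw
      rw [map_add]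
      exact add_mem hv hw
    · intro f v _ hv
      have : b.repr (f • v) i = (f : A⸨X⸩) * b.repr v i := by
        rw [show f • v = (f : A⸨X⸩) • v from rfl, map_smul, Finsupp.smul_apply, smul_eq_mul]
      rw [this]
      exact mul_mem f.2 hv
  · intro hv
    rw [← b.sum_repr v]
    exact Submodule.sum_mem _ fun i _ => Submodule.smul_mem _
      (⟨_, hv i⟩ : powerSeriesSubring A) (Submodule.subset_span ⟨i, rfl⟩)

theorem smul_mem_of_mem_powerSeriesSubring {L : Submodule (powerSeriesSubring A) E} {f : A⸨X⸩}
    (hf : f ∈ powerSeriesSubring A) {v : E} (hv : v ∈ L) : f • v ∈ L :=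
  L.smul_mem (⟨f, hf⟩ : powerSeriesSubring A) hv

theorem xVar_eq_xPow : xVar A = (xPow A 1 : A⸨X⸩) := rfl

theorem Connection.map_xPow_smul (D : Connection A E) (n : ℤ) (v : E) :
    D ((xPow A n : A⸨X⸩) • v) = (xPow A n : A⸨X⸩) • (D v + (HahnSeries.C (n : A) : A⸨X⸩) • v) := by
  rw [D.leibniz, theta_xPow, smul_add, smul_smul, mul_comm, add_comm]

/-- On the coefficients of `xⁿ` the operator `D - a` is triangular with diagonal entries `n + cᵢ -
a`, all nonzero, so it is injective there. -/
theorem HasTriangularMatrix.coeff_repr_eq_zero [IsDomain A] {ι : Type*} [Fintype ι]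
    {D : Connection A E} {b : Module.Basis ι A⸨X⸩ E} {c : ι → A} {N : ι → ι → A}
    (h : HasTriangularMatrix D b (fun i => HahnSeries.C (c i)) N) {ht : ι → ℕ}
    (hN : ∀ i j, N i j ≠ 0 → ht j < ht i) {n : ℤ} {a : A} (ha : ∀ i, a ≠ n + c i) {v : E}
    (hv : ∀ i, (b.repr (D v - (HahnSeries.C a : A⸨X⸩) • v) i).coeff n = 0) (i : ι) :
    (b.repr v i).coeff n = 0 := by
  refine h.repr_mem ht hN (coeffKer A n) C_mul_mem_coeffKer Set.univ (fun _ _ _ _ => trivial)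
    (HahnSeries.C a) ?_ v (fun i _ => hv i) i trivial
  intro j _ φ hφ
  rw [mem_coeffKer, HahnSeries.coeff_add, coeff_theta, ← map_sub, coeff_C_mul, ← add_mul] at hφ
  refine (mul_eq_zero.1 hφ).resolve_left fun h0 => ha j ?_
  linear_combination -h0

end Lattice

/-! ### Existence and uniqueness of the Deligne–Manin lattice -/

section DeligneManin

variable {K : Type*} [Field K] {M : Type*} [AddCommGroup M] [Module K⸨X⸩ M]
  {ι : Type*} [Fintype ι] {D : Connection K M} {b : Module.Basis ι K⸨X⸩ M} {c : ι → K}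
  {N : ι → ι → K} {ht : ι → ℕ} {τ : Set K}

/-- If `a ∉ τ`, then `D - a` is injective on constant coefficients. A vector with `(D - a)v ∈ xL`
thus has no constant coefficients and lies in `xL`, so `a` is not an exponent. -/
theorem isDeligneManinLattice_span (h : HasTriangularMatrix D b (fun i => HahnSeries.C (c i)) N)
    (hN : ∀ i j, N i j ≠ 0 → ht j < ht i) (hc : ∀ i, c i ∈ τ) :
    IsDeligneManinLattice τ D (Submodule.span (powerSeriesSubring K) (Set.range b)) where
  isLogModel := isRegularSingular_of_hasTriangularMatrix h
  exponents := by
    rintro a ⟨v, hv, hvx, w, hw, hvw⟩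
    by_contra ha
    refine hvx ⟨(xPow K (-1) : K⸨X⸩) • v, ?_, ?_⟩
    · rw [mem_span_powerSeriesSubring_iff]
      intro i n hn
      rw [map_smul, Finsupp.smul_apply, smul_eq_mul, coeff_xPow_mul]
      obtain hn' | hn' := lt_or_eq_of_le (show n - -1 ≤ 0 by omega)
      · exact (mem_span_powerSeriesSubring_iff b).1 hv i _ hn'
      · rw [hn']
        refine h.coeff_repr_eq_zero hN (a := a) (fun j hj => ha ?_) (fun j => ?_) i
        · rw [hj, Int.cast_zero, zero_add]
          exact hc j
        · rw [hvw, xVar_eq_xPow, map_smul, Finsupp.smul_apply, smul_eq_mul, coeff_xPow_mul]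
          exact (mem_span_powerSeriesSubring_iff b).1 hw j _ (by omega)
    · rw [xVar_eq_xPow, smul_smul, xPow_mul_xPow, add_neg_cancel, xPow_zero, one_smul]

theorem IsLogModel.exists_xPow_smul_mem {L : Submodule (powerSeriesSubring K) M}
    (hL : IsLogModel D L) (v : M) : ∃ n : ℕ, ∀ m : ℕ, n ≤ m → (xPow K m : K⸨X⸩) • v ∈ L := by
  have hv : v ∈ Submodule.span K⸨X⸩ (L : Set M) := by
    rw [hL.span_eq_top]
    trivial
  refine Submodule.span_induction (p := fun v _ => ∃ n : ℕ, ∀ m : ℕ, n ≤ m →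
    (xPow K m : K⸨X⸩) • v ∈ L) ?_ ?_ ?_ ?_ hv
  · exact fun v hv => ⟨0, fun m _ => smul_mem_of_mem_powerSeriesSubring
      (xPow_mem_powerSeriesSubring (Int.natCast_nonneg m)) hv⟩
  · exact ⟨0, fun m _ => by rw [smul_zero]; exact L.zero_mem⟩
  · rintro v w _ _ ⟨n, hn⟩ ⟨n', hn'⟩
    refine ⟨max n n', fun m hm => ?_⟩
    rw [smul_add]
    exact L.add_mem (hn m (le_of_max_le_left hm)) (hn' m (le_of_max_le_right hm))
  · rintro f v _ ⟨n, hn⟩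
    obtain ⟨n', hn'⟩ := exists_xPow_mul_mem f
    refine ⟨n + n', fun m hm => ?_⟩
    have h1 : ((m : ℤ)) = (n' : ℕ) + ((m - n' : ℕ) : ℤ) := by omega
    rw [h1, ← xPow_mul_xPow, smul_smul, mul_right_comm, ← smul_smul]
    exact smul_mem_of_mem_powerSeriesSubring (hn' n' le_rfl) (hn _ (by omega))

/-- Some `x^m b` lies in `L` for all basis vectors, and `m` can be lowered one by one, from the ends
of the strings backwards. If `xⁿ bⱼ` were not in `L`, then `x^{n+1} bⱼ` would be an eigenvector in
`L/xL` with eigenvalue `cⱼ + n + 1`, which is not in `τ`. -/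
theorem IsDeligneManinLattice.basis_mem [CharZero K] {L : Submodule (powerSeriesSubring K) M}
    (hL : IsDeligneManinLattice τ D L)
    (h : HasTriangularMatrix D b (fun i => HahnSeries.C (c i)) N)
    (hN : ∀ i j, N i j ≠ 0 → ht j < ht i) (hc : ∀ i, c i ∈ τ)
    (hτ : ∀ a ∈ τ, ∀ a' ∈ τ, (∃ k : ℤ, a - a' = k) → a = a') (i : ι) : b i ∈ L := by
  have hC : ∀ (a : K) {v : M}, v ∈ L → (HahnSeries.C a : K⸨X⸩) • v ∈ L := fun a v hv =>
    smul_mem_of_mem_powerSeriesSubring (C_mem_powerSeriesSubring a) hv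
  have step : ∀ n : ℕ, (∀ j, (xPow K ((n + 1 : ℕ) : ℤ) : K⸨X⸩) • b j ∈ L) →
      ∀ j, (xPow K n : K⸨X⸩) • b j ∈ L := by
    intro n hn
    refine induction_of_lt_height ht fun j ih => ?_
    set u : M := (xPow K ((n + 1 : ℕ) : ℤ) : K⸨X⸩) • b j with hu
    have hx : u = xVar K • (xPow K n : K⸨X⸩) • b j := by
      rw [smul_smul, xVar_mul_xPow, hu]
      push_cast
      rfl
    by_contra hj
    have hu1 : ¬ ∃ w ∈ L, u = xVar K • w := by
      rintro ⟨w, hw, huw⟩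
      have h1 : (xPow K (-1) : K⸨X⸩) • u = (xPow K (-1) : K⸨X⸩) • xVar K • w := by rw [huw]
      have h2 : (xPow K (-1) : K⸨X⸩) * xVar K = 1 := by
        rw [mul_comm, xVar_mul_xPow, neg_add_cancel, xPow_zero]
      have h3 : ∀ z : M, (xPow K (-1) : K⸨X⸩) • xVar K • z = z := fun z => by
        rw [smul_smul, h2, one_smul]
      rw [hx, h3, h3] at h1
      exact hj (h1 ▸ hw)
    have hexp := hL.exponents (c j + (n + 1 : ℕ)) ⟨u, hn j, hu1,
      ∑ k, (HahnSeries.C (N k j) : K⸨X⸩) • (xPow K n : K⸨X⸩) • b k, ?_, ?_⟩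
    -- Both `cⱼ + n + 1` and `cⱼ` would lie in `τ`, which forces `n + 1 = 0` in characteristic zero.
    · have := hτ _ hexp _ (hc j) ⟨(n + 1 : ℕ), by push_cast; ring⟩
      rw [add_eq_left] at this
      exact Nat.cast_ne_zero.2 (Nat.succ_ne_zero n) this
    · refine L.sum_mem fun k _ => ?_
      by_cases h0 : N k j = 0
      · rw [h0, map_zero, zero_smul]
        exact L.zero_mem
      · exact hC _ (ih k (hN k j h0))
    · rw [hu, D.map_xPow_smul, h j, Finset.smul_sum]
      have h1 : ∀ k, xVar K • (HahnSeries.C (N k j) : K⸨X⸩) • (xPow K n : K⸨X⸩) • b k =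
          (xPow K ((n + 1 : ℕ) : ℤ) : K⸨X⸩) • (HahnSeries.C (N k j) : K⸨X⸩) • b k := by
        intro k
        rw [smul_smul, smul_smul, smul_smul, mul_right_comm, xVar_mul_xPow]
        push_cast
        rfl
      simp only [h1]
      rw [← Finset.smul_sum, smul_smul, mul_comm, ← smul_smul, ← smul_sub, map_add, add_smul,
        Int.cast_natCast]
      congr 1
      abel
  have all : ∀ n : ℕ, (∀ j, (xPow K (n : ℤ) : K⸨X⸩) • b j ∈ L) → ∀ j, b j ∈ L := by
    intro n
    induction n with
    | zero =>
      intro hn j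
      have := hn j
      rwa [Nat.cast_zero, xPow_zero, one_smul] at this
    | succ n ih => exact fun hn => ih (step n hn)
  choose n hn using fun j => hL.isLogModel.exists_xPow_smul_mem (b j)
  exact all (Finset.univ.sup n) (fun j => hn j _ (Finset.le_sup (Finset.mem_univ j))) i

theorem aeval_intertwine {V W : Type*} [AddCommGroup V] [Module K V] [AddCommGroup W] [Module K W]
    {T : Module.End K V} {T' : Module.End K W} {f : V →ₗ[K] W} (h : ∀ v, f (T v) = T' (f v))
    (Q : Polynomial K) (v : V) : f (Polynomial.aeval T Q v) = Polynomial.aeval T' Q (f v) := by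
  induction Q using Polynomial.induction_on' with
  | add p q hp hq => simp only [map_add, LinearMap.add_apply, hp, hq]
  | monomial n a =>
    simp only [Polynomial.aeval_monomial, Module.End.mul_apply, Module.algebraMap_end_apply,
      map_smul]
    congr 1
    induction n generalizing v with
    | zero => rfl
    | succ n ih => rw [pow_succ, pow_succ, Module.End.mul_apply, Module.End.mul_apply, ih, h]

section Polynomial

variable [Module K M] [IsScalarTower K K⸨X⸩ M]

theorem C_smul_eq (a : K) (v : M) : (HahnSeries.C a : K⸨X⸩) • v = a • v := by
  rw [← mul_one (HahnSeries.C a : K⸨X⸩), HahnSeries.C_mul_eq_smul, smul_assoc, one_smul]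

/-- A connection as a linear map over the field of constants. -/
def Connection.toLinear (D : Connection K M) : Module.End K M where
  toFun := D
  map_add' := map_add D.toAddHom
  map_smul' a v := by
    rw [RingHom.id_apply, ← C_smul_eq a v, ← C_smul_eq a (D v)]
    exact D.map_const_smul a v

theorem Connection.toLinear_apply (D : Connection K M) (v : M) : D.toLinear v = D v := rfl

/-- A lattice as a vector space. -/
def latticeSubspace (L : Submodule (powerSeriesSubring K) M) : Submodule K M where
  carrier := L
  zero_mem' := L.zero_mem
  add_mem' := L.add_mem
  smul_mem' a v hv := by
    rw [← C_smul_eq]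
    exact smul_mem_of_mem_powerSeriesSubring (C_mem_powerSeriesSubring a) hv

/-- `L/xL` is finite-dimensional over `K`, so the residue satisfies a nonzero polynomial. -/
theorem IsLogModel.exists_polynomial {L : Submodule (powerSeriesSubring K) M}
    (hL : IsLogModel D L) : ∃ Q : Polynomial K, Q ≠ 0 ∧
      ∀ v ∈ L, ∃ w ∈ L, Polynomial.aeval D.toLinear Q v = xVar K • w := by
  set xlin : Module.End K M :=
    { toFun := fun v => xVar K • v
      map_add' := smul_add _
      map_smul' := fun a v => by
        simp only [← C_smul_eq, smul_smul, mul_comm, RingHom.id_apply] } with hxlin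
  set XL := (latticeSubspace L).map xlin with hXL
  have hmem : ∀ v, v ∈ XL ↔ ∃ w ∈ L, v = xVar K • w := by
    intro v
    constructor
    · rintro ⟨w, hw, rfl⟩
      exact ⟨w, hw, rfl⟩
    · rintro ⟨w, hw, rfl⟩
      exact ⟨w, hw, rfl⟩
  have hT : XL ≤ XL.comap D.toLinear := by
    intro v hv
    obtain ⟨w, hw, rfl⟩ := (hmem v).1 hv
    refine (hmem _).2 ⟨D w + (HahnSeries.C ((1 : ℤ) : K) : K⸨X⸩) • w, ?_, ?_⟩
    · exact L.add_mem (hL.stable w hw)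
        (smul_mem_of_mem_powerSeriesSubring (C_mem_powerSeriesSubring _) hw)
    · exact D.map_xPow_smul 1 w
  set T := XL.mapQ XL D.toLinear hT with hTdef
  -- `L/xL` is realised inside `M/xL`, on which `D` acts.
  set W := (latticeSubspace L).map XL.mkQ with hW
  have hTW : ∀ w ∈ W, T w ∈ W := by
    rintro _ ⟨v, hv, rfl⟩
    exact ⟨D v, hL.stable v hv, rfl⟩
  have hfin : FiniteDimensional K W := by
    obtain ⟨S, hS⟩ := hL.fg
    have : FiniteDimensional K (Submodule.span K (XL.mkQ '' (S : Set M))) :=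
      FiniteDimensional.span_of_finite K (S.finite_toSet.image _)
    refine Submodule.finiteDimensional_of_le (S₂ := Submodule.span K (XL.mkQ '' (S : Set M))) ?_
    rintro _ ⟨v, hv, rfl⟩
    replace hv : v ∈ L := hv
    rw [← hS] at hv
    refine Submodule.span_induction (p := fun v _ => XL.mkQ v ∈ Submodule.span K (XL.mkQ '' S))
      ?_ ?_ ?_ ?_ hv
    · exact fun v hv => Submodule.subset_span ⟨v, hv, rfl⟩
    · rw [map_zero]
      exact Submodule.zero_mem _
    · intro v w _ _ hv hw
      rw [map_add]
      exact Submodule.add_mem _ hv hw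
    · intro f v hv' hv
      rw [hS] at hv'
      -- Power series act on `L/xL` through their constant coefficients, so generators over `K[[x]]`
      -- span over `K`.
      have h1 : XL.mkQ (f • v) = (f : K⸨X⸩).coeff 0 • XL.mkQ v := by
        rw [← map_smul, ← sub_eq_zero, ← map_sub, Submodule.mkQ_apply,
          Submodule.Quotient.mk_eq_zero, hmem]
        refine ⟨((xPow K (-1) : K⸨X⸩) * ((f : K⸨X⸩) - HahnSeries.C ((f : K⸨X⸩).coeff 0))) • v,
          smul_mem_of_mem_powerSeriesSubring ?_ hv', ?_⟩
        · rw [mem_powerSeriesSubring_iff]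
          intro n hn
          rw [coeff_xPow_mul, HahnSeries.coeff_sub]
          obtain hn' | hn' := lt_or_eq_of_le (show n - -1 ≤ 0 by omega)
          · rw [mem_powerSeriesSubring_iff.1 f.2 _ hn',
              mem_powerSeriesSubring_iff.1 (C_mem_powerSeriesSubring _) _ hn', sub_zero]
          · rw [hn']
            simp
        · rw [smul_smul, ← mul_assoc, xVar_mul_xPow, neg_add_cancel, xPow_zero, one_mul, sub_smul,
            C_smul_eq]
          rfl
      rw [h1]
      exact Submodule.smul_mem _ _ hv
  obtain ⟨Q, hQ, hQ0⟩ := LinearMap.exists_monic_and_aeval_eq_zero K (T.restrict hTW)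
  refine ⟨Q, hQ.ne_zero, fun v hv => ?_⟩
  rw [← hmem, ← Submodule.Quotient.mk_eq_zero, ← Submodule.mkQ_apply,
    aeval_intertwine (T := D.toLinear) (T' := T) (f := XL.mkQ) (fun v => rfl)]
  have h1 := aeval_intertwine (T := T.restrict hTW) (T' := T) (f := W.subtype) (fun v => rfl) Q
    ⟨XL.mkQ v, ⟨v, hv, rfl⟩⟩
  rw [hQ0, LinearMap.zero_apply, map_zero] at h1
  exact h1.symm

theorem IsLogModel.aeval_mem {L : Submodule (powerSeriesSubring K) M} (hL : IsLogModel D L)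
    (Q : Polynomial K) {v : M} (hv : v ∈ L) : Polynomial.aeval D.toLinear Q v ∈ L := by
  have h1 := aeval_intertwine (T := D.toLinear.restrict (p := latticeSubspace L) hL.stable)
    (T' := D.toLinear) (f := (latticeSubspace L).subtype) (fun v => rfl) Q ⟨v, hv⟩
  rw [Submodule.subtype_apply, Submodule.subtype_apply] at h1
  rw [← h1]
  exact Subtype.prop _

/-- A polynomial `Q` of minimal degree works. If `Q = (X - a)Q'`, then by minimality some `Q'(D)v`
is not in `xL`; it is an eigenvector with eigenvalue `a`, so `a` is an exponent. -/
theorem IsDeligneManinLattice.exists_polynomial {L : Submodule (powerSeriesSubring K) M}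
    (hL : IsDeligneManinLattice τ D L) : ∃ Q : Polynomial K, Q ≠ 0 ∧ (∀ a, Q.IsRoot a → a ∈ τ) ∧
      ∀ v ∈ L, ∃ w ∈ L, Polynomial.aeval D.toLinear Q v = xVar K • w := by
  classical
  have hex : ∃ n : ℕ, ∃ Q : Polynomial K, Q.natDegree = n ∧ Q ≠ 0 ∧
      ∀ v ∈ L, ∃ w ∈ L, Polynomial.aeval D.toLinear Q v = xVar K • w := by
    obtain ⟨Q, hQ⟩ := hL.isLogModel.exists_polynomial
    exact ⟨_, Q, rfl, hQ⟩
  obtain ⟨Q, hdeg, hQ0, hQ⟩ := Nat.find_spec hex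
  refine ⟨Q, hQ0, fun a ha => ?_, hQ⟩
  obtain ⟨Q', rfl⟩ := Polynomial.dvd_iff_isRoot.2 ha
  have hQ'0 : Q' ≠ 0 := right_ne_zero_of_mul hQ0
  have hlt : Q'.natDegree < Nat.find hex := by
    rw [← hdeg, Polynomial.natDegree_mul (Polynomial.X_sub_C_ne_zero a) hQ'0,
      Polynomial.natDegree_X_sub_C]
    omega
  have hQ' : ∃ v ∈ L, ¬ ∃ w ∈ L, Polynomial.aeval D.toLinear Q' v = xVar K • w := by
    by_contra! hall
    exact Nat.find_min hex hlt ⟨Q', rfl, hQ'0, hall⟩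
  obtain ⟨v, hv, hv'⟩ := hQ'
  refine hL.exponents a ⟨_, hL.isLogModel.aeval_mem Q' hv, hv', ?_⟩
  obtain ⟨w, hw, hvw⟩ := hQ v hv
  refine ⟨w, hw, ?_⟩
  rw [← hvw, map_mul, Module.End.mul_apply, map_sub, Polynomial.aeval_X, Polynomial.aeval_C,
    LinearMap.sub_apply, Module.algebraMap_end_apply, C_smul_eq]
  rfl

/-- `Q` splits into linear factors, each injective on the coefficients of `xⁿ`. -/
theorem HasTriangularMatrix.coeff_repr_eq_zero_of_aeval [IsAlgClosed K]
    (h : HasTriangularMatrix D b (fun i => HahnSeries.C (c i)) N)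
    (hN : ∀ i j, N i j ≠ 0 → ht j < ht i) {n : ℤ} {Q : Polynomial K} (hQ : Q ≠ 0)
    (hroot : ∀ a, Q.IsRoot a → ∀ i, a ≠ n + c i) {v : M}
    (hv : ∀ i, (b.repr (Polynomial.aeval D.toLinear Q v) i).coeff n = 0) (i : ι) :
    (b.repr v i).coeff n = 0 := by
  induction hd : Q.natDegree generalizing Q i with
  | zero =>
    obtain ⟨a, rfl⟩ : ∃ a, Q = Polynomial.C a := ⟨_, Polynomial.eq_C_of_natDegree_eq_zero hd⟩
    have ha : a ≠ 0 := fun h0 => hQ (by rw [h0, Polynomial.C_0])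
    have h1 := hv i
    rw [Polynomial.aeval_C, Module.algebraMap_end_apply, ← C_smul_eq, map_smul,
      Finsupp.smul_apply, smul_eq_mul, coeff_C_mul] at h1
    exact (mul_eq_zero.1 h1).resolve_left ha
  | succ m ih =>
    obtain ⟨a, ha⟩ := IsAlgClosed.exists_root Q (by
      rw [Polynomial.degree_eq_natDegree hQ, hd]
      exact Nat.cast_ne_zero.2 (Nat.succ_ne_zero m))
    obtain ⟨Q', rfl⟩ := Polynomial.dvd_iff_isRoot.2 ha
    have hQ'0 : Q' ≠ 0 := right_ne_zero_of_mul hQ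
    refine ih hQ'0 (fun a' ha' => hroot a' (Polynomial.root_mul_left_of_isRoot _ ha')) ?_ i ?_
    · refine h.coeff_repr_eq_zero hN (hroot a ha) fun j => ?_
      have h1 := hv j
      rw [map_mul, Module.End.mul_apply, map_sub, Polynomial.aeval_X, Polynomial.aeval_C,
        LinearMap.sub_apply, Module.algebraMap_end_apply] at h1
      rw [C_smul_eq]
      exact h1
    · rw [Polynomial.natDegree_mul (Polynomial.X_sub_C_ne_zero a) hQ'0,
        Polynomial.natDegree_X_sub_C] at hd
      omega

/-- The pole order of coordinates of vectors of `L` is bounded and can be lowered to zero. If it is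
at most `m + 1` on `L`, it is at most `m` on `xL`, which contains `Q(D)L`; and `Q(D)` is injective
on coefficients of `x^{-(m+1)}` because its roots lie in `τ`. -/
theorem IsDeligneManinLattice.coeff_repr_eq_zero [IsAlgClosed K] [CharZero K]
    {L : Submodule (powerSeriesSubring K) M}
    (hL : IsDeligneManinLattice τ D L)
    (h : HasTriangularMatrix D b (fun i => HahnSeries.C (c i)) N)
    (hN : ∀ i j, N i j ≠ 0 → ht j < ht i) (hc : ∀ i, c i ∈ τ)
    (hτ : ∀ a ∈ τ, ∀ a' ∈ τ, (∃ k : ℤ, a - a' = k) → a = a') {v : M} (hv : v ∈ L) (i : ι)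
    {n : ℤ} (hn : n < 0) : (b.repr v i).coeff n = 0 := by
  obtain ⟨Q, hQ0, hQτ, hQ⟩ := hL.exists_polynomial
  have step : ∀ m : ℕ, (∀ v ∈ L, ∀ i, ∀ n : ℤ, n < -((m + 1 : ℕ) : ℤ) → (b.repr v i).coeff n = 0) →
      ∀ v ∈ L, ∀ i, ∀ n : ℤ, n < -(m : ℤ) → (b.repr v i).coeff n = 0 := by
    intro m hm v hv i n hn
    obtain hn' | rfl := lt_or_eq_of_le (show n ≤ -((m + 1 : ℕ) : ℤ) by push_cast; omega)
    · exact hm v hv i n hn'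
    · refine h.coeff_repr_eq_zero_of_aeval hN hQ0 (fun a ha j haj => ?_) (fun j => ?_) i
      -- A root `a = n + cⱼ` would lie in `τ` together with `cⱼ`, so `n = 0`, whereas `n = -(m +
      -- 1)`.
      · have h1 := hτ a (hQτ a ha) (c j) (hc j) ⟨_, sub_eq_iff_eq_add.2 haj⟩
        rw [h1, right_eq_add, Int.cast_eq_zero] at haj
        omega
      · obtain ⟨w, hw, hvw⟩ := hQ v hv
        rw [hvw, xVar_eq_xPow, map_smul, Finsupp.smul_apply, smul_eq_mul, coeff_xPow_mul]
        exact hm w hw j _ (by omega)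
  have all : ∀ m : ℕ, (∀ v ∈ L, ∀ i, ∀ n : ℤ, n < -(m : ℤ) → (b.repr v i).coeff n = 0) →
      ∀ v ∈ L, ∀ i, ∀ n : ℤ, n < 0 → (b.repr v i).coeff n = 0 := by
    intro m
    induction m with
    | zero => simp
    | succ m ih => exact fun hm => ih (step m hm)
  have bound : ∃ m : ℕ, ∀ v ∈ L, ∀ i, ∀ n : ℤ, n < -(m : ℤ) → (b.repr v i).coeff n = 0 := by
    have hex : ∀ v : M, ∃ m : ℕ, ∀ k : ℕ, m ≤ k → ∀ i,
        (xPow K k : K⸨X⸩) * b.repr v i ∈ powerSeriesSubring K := by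
      intro v
      choose m hm using fun i => exists_xPow_mul_mem (b.repr v i)
      exact ⟨Finset.univ.sup m, fun k hk i =>
        hm i k ((Finset.le_sup (Finset.mem_univ i)).trans hk)⟩
    choose m hm using hex
    obtain ⟨S, hS⟩ := hL.isLogModel.fg
    refine ⟨S.sup m, fun v hv i n hn => ?_⟩
    have key : ∀ v ∈ L, (xPow K (S.sup m : ℕ) : K⸨X⸩) * b.repr v i ∈ powerSeriesSubring K := by
      intro v hv
      rw [← hS] at hv
      refine Submodule.span_induction (p := fun v _ =>
        (xPow K (S.sup m : ℕ) : K⸨X⸩) * b.repr v i ∈ powerSeriesSubring K) ?_ ?_ ?_ ?_ hv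
      · exact fun v hv => hm v _ (Finset.le_sup hv) i
      · rw [map_zero, Finsupp.zero_apply, mul_zero]
        exact zero_mem _
      · intro v w _ _ hv hw
        rw [map_add, Finsupp.add_apply, mul_add]
        exact add_mem hv hw
      · intro f v _ hv
        rw [show f • v = (f : K⸨X⸩) • v from rfl, map_smul, Finsupp.smul_apply, smul_eq_mul,
          mul_left_comm]
        exact mul_mem f.2 hv
    have h1 := mem_powerSeriesSubring_iff.1 (key v hv) (n + (S.sup m : ℕ)) (by omega)
    rwa [coeff_xPow_mul, add_sub_cancel_right] at h1
  obtain ⟨m, hm⟩ := bound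
  exact all m hm v hv i n hn

end Polynomial

theorem IsDeligneManinLattice.eq_span [IsAlgClosed K] [CharZero K]
    {L : Submodule (powerSeriesSubring K) M} (hL : IsDeligneManinLattice τ D L)
    (h : HasTriangularMatrix D b (fun i => HahnSeries.C (c i)) N)
    (hN : ∀ i j, N i j ≠ 0 → ht j < ht i) (hc : ∀ i, c i ∈ τ)
    (hτ : ∀ a ∈ τ, ∀ a' ∈ τ, (∃ k : ℤ, a - a' = k) → a = a') :
    L = Submodule.span (powerSeriesSubring K) (Set.range b) := by
  -- The polynomial arguments need `M` as a vector space over the constants.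
  let _ : Module K M := Module.compHom M (HahnSeries.C : K →+* K⸨X⸩)
  have : IsScalarTower K K⸨X⸩ M := ⟨fun a f v => by
    rw [← HahnSeries.C_mul_eq_smul, mul_smul]
    rfl⟩
  apply le_antisymm
  · intro v hv
    rw [mem_span_powerSeriesSubring_iff]
    exact fun i n hn => hL.coeff_repr_eq_zero h hN hc hτ hv i hn
  · rw [Submodule.span_le]
    rintro _ ⟨i, rfl⟩
    exact hL.basis_mem h hN hc hτ i

end DeligneManin

/-! ### Jordan normal form of nilpotent endomorphisms -/

section Jordan

open Polynomial in
theorem exists_basis_quotient_X_pow (K : Type*) [Field K] (k : ℕ) :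
    ∃ b : Module.Basis (Fin k) K (K[X] ⧸ (Submodule.span K[X] {(X : K[X]) ^ k})),
      ∀ j, b j = Submodule.Quotient.mk (X ^ (j : ℕ)) := by
  have hm : (X ^ k : K[X]).Monic := monic_X_pow k
  let b : Module.Basis (Fin (X ^ k : K[X]).natDegree) K
    (K[X] ⧸ (Submodule.span K[X] {(X : K[X]) ^ k})) := AdjoinRoot.powerBasisAux' hm
  refine ⟨b.reindex (finCongr (natDegree_X_pow k)), fun j => ?_⟩
  rw [Module.Basis.reindex_apply]
  have h := (AdjoinRoot.powerBasis' hm).basis_eq_pow ((finCongr (natDegree_X_pow k)).symm j)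
  exact h

open Polynomial in
/-- Jordan normal form of a locally nilpotent endomorphism. -/
theorem exists_jordan_basis {K V : Type*} [Field K] [AddCommGroup V] [Module K V]
    [FiniteDimensional K V] (T : Module.End K V) (hT : ∀ v, ∃ q : ℕ, (T ^ q) v = 0) :
    ∃ (d : ℕ) (k : Fin d → ℕ) (b : Module.Basis (Σ i, Fin (k i)) K V),
      ∀ x, T (b x) = (chainNext (fun _ _ => true) x).elim 0 b := by
  classical
  -- With `X` acting as `T`, the space is an `X`-power torsion module, hence a sum of modules
  -- `K[X]/(X^k)`; the powers of `X` in each summand form a string.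
  have htors : Module.IsTorsion' (Module.AEval' T) (Submonoid.powers (X : K[X])) := by
    intro m
    obtain ⟨v, rfl⟩ := (Module.AEval'.of T).surjective m
    obtain ⟨q, hq⟩ := hT v
    refine ⟨⟨X ^ q, q, rfl⟩, ?_⟩
    show (X ^ q : K[X]) • Module.AEval'.of T v = 0
    rw [Module.AEval'.X_pow_smul_of, Module.End.smul_def, hq, map_zero]
  obtain ⟨d, k, ⟨e⟩⟩ := Module.torsion_by_prime_power_decomposition irreducible_X htors
  choose q hq using fun i => exists_basis_quotient_X_pow K (k i)
  let B : Module.Basis (Σ i, Fin (k i)) K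
    (DirectSum (Fin d) fun i => K[X] ⧸ (Submodule.span K[X] {(X : K[X]) ^ k i})) :=
    DFinsupp.basis q
  have hB : ∀ i j, B ⟨i, j⟩ = DirectSum.lof K[X] (Fin d)
      (fun i => K[X] ⧸ (Submodule.span K[X] {(X : K[X]) ^ k i})) i
        (Submodule.Quotient.mk (X ^ (j : ℕ))) := by
    intro i j
    rw [← hq]
    rw [Module.Basis.apply_eq_iff]
    show (sigmaFinsuppLequivDFinsupp K).symm (DFinsupp.mapRange.linearEquiv (fun i => (q i).repr)
      (DFinsupp.single i (q i j))) = Finsupp.single ⟨i, j⟩ 1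
    rw [LinearEquiv.symm_apply_eq, DFinsupp.mapRange.linearEquiv_apply, DFinsupp.mapRange_single,
      Module.Basis.repr_self]
    exact (sigmaFinsuppEquivDFinsupp_single (⟨i, j⟩ : Σ i, Fin (k i)) (1 : K)).symm
  refine ⟨d, k, B.map ((Module.AEval'.of T).trans (e.restrictScalars K)).symm, ?_⟩
  rintro ⟨i, j⟩
  have hN : ∀ z, T (((Module.AEval'.of T).trans (e.restrictScalars K)).symm z) =
      ((Module.AEval'.of T).trans (e.restrictScalars K)).symm ((X : K[X]) • z) := by
    intro z
    rw [LinearEquiv.eq_symm_apply]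
    simp only [LinearEquiv.trans_apply, ← Module.AEval'.X_smul_of, LinearEquiv.trans_symm,
      LinearEquiv.apply_symm_apply, LinearEquiv.restrictScalars_apply, map_smul]
    congr 1
    exact e.apply_symm_apply z
  rw [Module.Basis.map_apply, hN, hB, ← map_smul, ← Submodule.Quotient.mk_smul, smul_eq_mul,
    ← pow_succ']
  unfold chainNext
  split_ifs with h
  · rw [Option.elim_some, Module.Basis.map_apply, hB]
  · have h1 : (j : ℕ) + 1 = k i := by
      have := j.2
      simp only [and_true, not_lt] at h
      omega
    rw [h1, (Submodule.Quotient.mk_eq_zero _).2 (Submodule.mem_span_singleton_self _), map_zero,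
      map_zero]
    rfl

end Jordan

/-! ### From Jordan strings over the constants to a basis over `K((x))` -/

section Glue

variable {K : Type*} [Field K] {M : Type*} [AddCommGroup M] [Module K⸨X⸩ M]
  [Module K M] [IsScalarTower K K⸨X⸩ M]

/-- A basis of Jordan strings from finite-dimensional spaces on which the connection acts as a
scalar plus a nilpotent map. -/
theorem exists_chain_basis {κ : Type*} [Fintype κ] (D : Connection K M) (γ : κ → K)
    (V : κ → Submodule K M) [∀ i, FiniteDimensional K (V i)]
    (hV : ∀ i, ∀ v ∈ V i, D v - (HahnSeries.C (γ i) : K⸨X⸩) • v ∈ V i)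
    (hnil : ∀ i, V i ≤ D.toLinear.maxGenEigenspace (γ i))
    (hspan : ⊤ ≤ Submodule.span K⸨X⸩ (⋃ i, (V i : Set M)))
    (hrank : ∑ i, Module.finrank K (V i) ≤ Module.finrank K⸨X⸩ M) :
    ∃ (d : κ → ℕ) (r : (Σ i, Fin (d i)) → ℕ) (b : Module.Basis (Σ a, Fin (r a)) K⸨X⸩ M),
      (∀ x, b x ∈ V x.1.1) ∧ (∀ i, V i ≤ Submodule.span K (Set.range b)) ∧
      HasTriangularMatrix D b (fun x => HahnSeries.C (γ x.1.1))
        (chainMatrix K fun _ _ => true) := by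
  have hT : ∀ i, ∀ v ∈ V i, (D.toLinear - algebraMap K (Module.End K M) (γ i)) v ∈ V i := by
    intro i v hv
    rw [LinearMap.sub_apply, Module.algebraMap_end_apply, ← C_smul_eq]
    exact hV i v hv
  have hjordan := fun i => exists_jordan_basis
    ((D.toLinear - algebraMap K (Module.End K M) (γ i)).restrict (hT i)) (by
      intro v
      obtain ⟨q, hq⟩ := Module.End.mem_maxGenEigenspace _ _ _ |>.1 (hnil i v.2)
      refine ⟨q, Subtype.ext ?_⟩
      have h1 := aeval_intertwine (f := (V i).subtype)
        (T := (D.toLinear - algebraMap K (Module.End K M) (γ i)).restrict (hT i))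
        (T' := D.toLinear - algebraMap K (Module.End K M) (γ i)) (fun v => rfl)
        (Polynomial.X ^ q) v
      rw [map_pow, map_pow, Polynomial.aeval_X, Polynomial.aeval_X] at h1
      refine h1.trans (Eq.trans ?_ hq)
      rw [Algebra.algebraMap_eq_smul_one]
      rfl)
  choose d k B hB using hjordan
  let f : (Σ a : (Σ i, Fin (d i)), Fin (k a.1 a.2)) → M := fun x => B x.1.1 ⟨x.1.2, x.2⟩
  have hVf : ∀ i, V i ≤ Submodule.span K (Set.range f) := by
    intro i v hv
    have h1 := congrArg (V i).subtype ((B i).sum_repr ⟨v, hv⟩)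
    rw [map_sum] at h1
    rw [show v = _ from h1.symm]
    refine Submodule.sum_mem _ fun y _ => ?_
    rw [map_smul]
    exact Submodule.smul_mem _ _ (Submodule.subset_span ⟨⟨⟨i, y.1⟩, y.2⟩, rfl⟩)
  have hf : ⊤ ≤ Submodule.span K⸨X⸩ (Set.range f) := by
    refine hspan.trans (Submodule.span_le.2 (Set.iUnion_subset fun i v hv => ?_))
    exact Submodule.span_le_restrictScalars K K⸨X⸩ _ (hVf i hv)
  -- The strings generate `M`, and by `hrank` there are no more of them than the rank, so they form
  -- a basis.
  have hcard : Fintype.card (Σ a : (Σ i, Fin (d i)), Fin (k a.1 a.2)) = Module.finrank K⸨X⸩ M := by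
    apply le_antisymm
    · refine le_trans (le_of_eq ?_) hrank
      rw [Fintype.card_sigma, Fintype.sum_sigma]
      refine Finset.sum_congr rfl fun i _ => ?_
      rw [Module.finrank_eq_card_basis (B i), Fintype.card_sigma]
    · have h1 := finrank_range_le_card (R := K⸨X⸩) f
      rw [Set.finrank, top_le_iff.1 hf, finrank_top] at h1
      exact h1
  have hb : ∀ x, basisOfTopLeSpanOfCardEqFinrank f hf hcard x = f x := fun x => by
    rw [coe_basisOfTopLeSpanOfCardEqFinrank]
  refine ⟨d, fun a => k a.1 a.2, basisOfTopLeSpanOfCardEqFinrank f hf hcard, ?_, ?_, ?_⟩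
  · intro x
    rw [hb]
    exact (B x.1.1 ⟨x.1.2, x.2⟩).2
  · rwa [coe_basisOfTopLeSpanOfCardEqFinrank]
  · intro x
    rw [sum_chainMatrix_smul, ← sub_eq_iff_eq_add', hb, C_smul_eq]
    have h1 := congrArg Subtype.val (hB x.1.1 ⟨x.1.2, x.2⟩)
    refine Eq.trans h1 ?_
    unfold chainNext
    split_ifs
    · rw [Option.elim_some, Option.elim_some, hb]
    · rfl

end Glue

/-! ### Expansion in powers of `t`, completeness, and the truncated exponential -/

section Coefficients

variable {C R : Type*} [Field C] [CommRing R] [Algebra C R] {t : R}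

theorem coeffMap_coeff (f : C⸨X⸩) (n : ℤ) :
    (coeffMap C R f).coeff n = algebraMap C R (f.coeff n) := rfl

theorem coeffMap_C (a : C) :
    coeffMap C R (HahnSeries.C a : C⸨X⸩) = HahnSeries.C (algebraMap C R a) := by
  ext n
  rw [coeffMap_coeff]
  by_cases h : n = 0
  · simp [h]
  · rw [HahnSeries.C_apply, HahnSeries.C_apply, HahnSeries.coeff_single_of_ne h,
      HahnSeries.coeff_single_of_ne h, map_zero]

theorem isDomain_of_algEquiv (e : R ≃ₐ[C] PowerSeries C) : IsDomain R :=
  MulEquiv.isDomain (PowerSeries C) e.toMulEquiv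

/-- The coefficient of `t ^ k` of an element of `R ≅ C[[t]]`. -/
def tCoeff (e : R ≃ₐ[C] PowerSeries C) (k : ℕ) : R →+ C :=
  (PowerSeries.coeff (R := C) k).toAddMonoidHom.comp (e : R →+ PowerSeries C)

theorem tCoeff_apply (e : R ≃ₐ[C] PowerSeries C) (k : ℕ) (a : R) :
    tCoeff e k a = PowerSeries.coeff k (e a) := rfl

theorem pow_dvd_iff_tCoeff (e : R ≃ₐ[C] PowerSeries C) (ht : e t = PowerSeries.X) {n : ℕ} {a : R} :
    t ^ n ∣ a ↔ ∀ m < n, tCoeff e m a = 0 := by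
  rw [← map_dvd_iff e, map_pow, ht, PowerSeries.X_pow_dvd_iff]
  rfl

theorem tCoeff_algebraMap_mul_pow (e : R ≃ₐ[C] PowerSeries C) (ht : e t = PowerSeries.X)
    (m k : ℕ) (c : C) : tCoeff e m (algebraMap C R c * t ^ k) = if m = k then c else 0 := by
  rw [tCoeff_apply, map_mul, map_pow, ht, AlgEquiv.commutes, PowerSeries.algebraMap_apply,
    Algebra.algebraMap_self, RingHom.id_apply, PowerSeries.coeff_C_mul, PowerSeries.coeff_X_pow,
    mul_ite, mul_one, mul_zero]

theorem tCoeff_sum (e : R ≃ₐ[C] PowerSeries C) (ht : e t = PowerSeries.X) {l m : ℕ}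
    (hm : m < l) (c : Fin l → C) :
    tCoeff e m (∑ k : Fin l, algebraMap C R (c k) * t ^ (k : ℕ)) = c ⟨m, hm⟩ := by
  simp only [map_sum, tCoeff_algebraMap_mul_pow e ht]
  rw [Finset.sum_eq_single ⟨m, hm⟩]
  · rw [if_pos rfl]
  · intro k _ hk
    rw [if_neg]
    intro h
    exact hk (Fin.ext h.symm)
  · simp

theorem pow_dvd_sub_sum_tCoeff (e : R ≃ₐ[C] PowerSeries C) (ht : e t = PowerSeries.X) (l : ℕ)
    (a : R) : t ^ l ∣ a - ∑ k : Fin l, algebraMap C R (tCoeff e k a) * t ^ (k : ℕ) := by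
  rw [pow_dvd_iff_tCoeff e ht]
  intro m hm
  rw [map_sub, tCoeff_sum e ht hm, sub_self]

theorem eq_zero_of_forall_pow_dvd (e : R ≃ₐ[C] PowerSeries C) (ht : e t = PowerSeries.X) {a : R}
    (h : ∀ l : ℕ, t ^ (l + 1) ∣ a) : a = 0 := by
  apply e.injective
  rw [map_zero]
  ext m
  exact (pow_dvd_iff_tCoeff e ht).1 (h m) m (Nat.lt_succ_self m)

/-- The coefficient of `t^m` is constant in the sequence from index `m` on. -/
theorem exists_limit (e : R ≃ₐ[C] PowerSeries C) (ht : e t = PowerSeries.X) (a : ℕ → R)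
    (h : ∀ l : ℕ, t ^ (l + 1) ∣ a (l + 1) - a l) : ∃ b : R, ∀ l : ℕ, t ^ (l + 1) ∣ b - a l := by
  have h1 : ∀ m l : ℕ, m ≤ l → tCoeff e m (a l) = tCoeff e m (a m) := by
    intro m l hml
    induction l, hml using Nat.le_induction with
    | base => rfl
    | succ l hl ih =>
      have h2 := (pow_dvd_iff_tCoeff e ht).1 (h l) m (Nat.lt_succ_of_le hl)
      rw [map_sub, sub_eq_zero] at h2
      rw [h2, ih]
  refine ⟨e.symm (PowerSeries.mk fun m => tCoeff e m (a m)), fun l => ?_⟩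
  rw [pow_dvd_iff_tCoeff e ht]
  intro m hm
  rw [map_sub, tCoeff_apply, AlgEquiv.apply_symm_apply, PowerSeries.coeff_mk,
    h1 m l (Nat.le_of_lt_succ hm), sub_self]

/-- The restriction to `R[[x]]` matters: with unbounded poles the coefficientwise limit might not be
a Laurent series. -/
theorem exists_limit_series (e : R ≃ₐ[C] PowerSeries C) (ht : e t = PowerSeries.X)
    (f : ℕ → R⸨X⸩) (hf : ∀ l, f l ∈ powerSeriesSubring R)
    (h : ∀ l : ℕ, (HahnSeries.C (t ^ (l + 1)) : R⸨X⸩) ∣ f (l + 1) - f l) :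
    ∃ g ∈ powerSeriesSubring R, ∀ l : ℕ, (HahnSeries.C (t ^ (l + 1)) : R⸨X⸩) ∣ g - f l := by
  choose b hb using fun n : ℕ => exists_limit e ht (fun l => (f l).coeff n) fun l => by
    have := C_dvd_iff.1 (h l) n
    rwa [HahnSeries.coeff_sub] at this
  refine ⟨HahnSeries.ofPowerSeries ℤ R (PowerSeries.mk b), ⟨_, rfl⟩, fun l => ?_⟩
  rw [C_dvd_iff]
  intro n
  rw [HahnSeries.coeff_sub]
  by_cases hn : n < 0
  · rw [mem_powerSeriesSubring_iff.1 (hf l) n hn,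
      mem_powerSeriesSubring_iff.1 (⟨_, rfl⟩ : HahnSeries.ofPowerSeries ℤ R (PowerSeries.mk b) ∈
        powerSeriesSubring R) n hn, sub_zero]
    exact dvd_zero _
  · obtain ⟨m, rfl⟩ := Int.eq_ofNat_of_zero_le (not_lt.1 hn)
    rw [HahnSeries.ofPowerSeries_apply_coeff, PowerSeries.coeff_mk]
    exact hb m l

/-- The coefficient of `t ^ k` of a Laurent series over `R ≅ C[[t]]`. -/
def tCoeffSeries (e : R ≃ₐ[C] PowerSeries C) (k : ℕ) (f : R⸨X⸩) : C⸨X⸩ :=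
  HahnSeries.map f (tCoeff e k)

theorem tCoeffSeries_coeff (e : R ≃ₐ[C] PowerSeries C) (k : ℕ) (f : R⸨X⸩) (n : ℤ) :
    (tCoeffSeries e k f).coeff n = tCoeff e k (f.coeff n) := rfl

theorem coeff_sum_coeffMap_mul {l : ℕ} (g : Fin l → C⸨X⸩) (n : ℤ) :
    (∑ k : Fin l, coeffMap C R (g k) * HahnSeries.C (t ^ (k : ℕ))).coeff n =
      ∑ k : Fin l, algebraMap C R ((g k).coeff n) * t ^ (k : ℕ) := by
  rw [HahnSeries.coeff_sum]
  refine Finset.sum_congr rfl fun k _ => ?_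
  rw [mul_comm, coeff_C_mul, coeffMap_coeff, mul_comm]

theorem C_pow_dvd_sub_sum (e : R ≃ₐ[C] PowerSeries C) (ht : e t = PowerSeries.X) (l : ℕ)
    (f : R⸨X⸩) : (HahnSeries.C (t ^ l) : R⸨X⸩) ∣
      f - ∑ k : Fin l, coeffMap C R (tCoeffSeries e k f) * HahnSeries.C (t ^ (k : ℕ)) := by
  rw [C_dvd_iff]
  intro n
  rw [HahnSeries.coeff_sub, coeff_sum_coeffMap_mul]
  exact pow_dvd_sub_sum_tCoeff e ht l _

theorem eq_zero_of_C_pow_dvd_sum (e : R ≃ₐ[C] PowerSeries C) (ht : e t = PowerSeries.X) {l : ℕ}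
    {g : Fin l → C⸨X⸩} (h : (HahnSeries.C (t ^ l) : R⸨X⸩) ∣
      ∑ k : Fin l, coeffMap C R (g k) * HahnSeries.C (t ^ (k : ℕ))) (k : Fin l) : g k = 0 := by
  ext n
  have h1 := C_dvd_iff.1 h n
  rw [coeff_sum_coeffMap_mul] at h1
  have h2 := (pow_dvd_iff_tCoeff e ht).1 h1 k k.2
  rw [tCoeff_sum e ht k.2 (fun k => (g k).coeff n)] at h2
  exact h2

theorem dvd_sub_algebraMap_tCoeff (e : R ≃ₐ[C] PowerSeries C) (ht : e t = PowerSeries.X) (a : R) :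
    t ∣ a - algebraMap C R (tCoeff e 0 a) := by
  have h := pow_dvd_sub_sum_tCoeff e ht 1 a
  simpa using h

theorem tCoeff_zero_algebraMap (e : R ≃ₐ[C] PowerSeries C) (c : C) :
    tCoeff e 0 (algebraMap C R c) = c := by
  rw [tCoeff_apply, AlgEquiv.commutes, PowerSeries.algebraMap_apply, Algebra.algebraMap_self,
    RingHom.id_apply, PowerSeries.coeff_zero_C]

theorem tCoeff_zero_intCast (e : R ≃ₐ[C] PowerSeries C) (n : ℤ) :
    tCoeff e 0 (n : R) = n := by
  rw [← map_intCast (algebraMap C R), tCoeff_zero_algebraMap]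

/-- Truncations of `exp (∫ (p₀ - p) dx / x)`, where `p₀` is the reduction of the polar
series `p` modulo `t`. -/
theorem exists_truncated_exp [CharZero C] (e : R ≃ₐ[C] PowerSeries C) (ht : e t = PowerSeries.X)
    {p : R⸨X⸩} (hp : IsPolar p) :
    ∃ (p₀ : C⸨X⸩) (u : ℕ → R⸨X⸩), IsPolar p₀ ∧ ∀ l : ℕ,
      (HahnSeries.C (t ^ (l + 1)) : R⸨X⸩) ∣ theta (u l) - (coeffMap C R p₀ - p) * u l ∧
      (∃ s, (HahnSeries.C (t ^ (l + 1)) : R⸨X⸩) ∣ u l * s - 1) ∧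
      (HahnSeries.C (t ^ (l + 1)) : R⸨X⸩) ∣ u (l + 1) - u l := by
  set p₀ : C⸨X⸩ := tCoeffSeries e 0 p with hp₀
  have hp₀' : IsPolar p₀ := fun n hn => by
    rw [hp₀, tCoeffSeries_coeff, hp n hn, map_zero]
  set q : R⸨X⸩ := coeffMap C R p₀ - p with hq
  have hq0 : q.coeff 0 = 0 := by
    rw [hq, HahnSeries.coeff_sub, hp 0 le_rfl, coeffMap_coeff, hp₀' 0 le_rfl, map_zero, sub_zero]
  have hqt : ∀ n, t ∣ q.coeff n := by
    intro n
    rw [hq, HahnSeries.coeff_sub, coeffMap_coeff, hp₀, tCoeffSeries_coeff, ← dvd_neg, neg_sub]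
    exact dvd_sub_algebraMap_tCoeff e ht _
  -- A primitive of `q` for `ϑ`. As `q` has no constant coefficient, the default value `0⁻¹ = 0` at
  -- `n = 0` is harmless.
  let g : R⸨X⸩ := ⟨fun n => algebraMap C R ((n : C)⁻¹) * q.coeff n,
    q.isPWO_support.mono fun n hn h0 => hn (by
      have h1 : q.coeff n = 0 := h0
      show _ * q.coeff n = 0
      rw [h1, mul_zero])⟩
  have hg : theta g = q := by
    ext n
    rw [coeff_theta]
    show (n : R) * (algebraMap C R ((n : C)⁻¹) * q.coeff n) = q.coeff n
    by_cases hn : n = 0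
    · rw [hn, hq0, mul_zero, mul_zero]
    · rw [← mul_assoc, ← map_intCast (algebraMap C R), ← map_mul,
        mul_inv_cancel₀ (Int.cast_ne_zero.2 hn), map_one, one_mul]
  have hgt : (HahnSeries.C t : R⸨X⸩) ∣ g :=
    C_dvd_of_dvd_coeff fun n => Dvd.dvd.mul_left (hqt n) _
  have hgpow : ∀ k, (HahnSeries.C (t ^ k) : R⸨X⸩) ∣ g ^ k := fun k => by
    rw [map_pow]
    exact pow_dvd_pow_of_dvd hgt k
  let a : ℕ → R := fun k => algebraMap C R ((k.factorial : C)⁻¹)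
  have ha : ∀ k : ℕ, a (k + 1) * ((k : R) + 1) = a k := by
    intro k
    have h1 : ((k : R) + 1) = algebraMap C R ((k : C) + 1) := by simp
    rw [h1, ← map_mul]
    congr 1
    have h2 : (k.factorial : C) ≠ 0 := Nat.cast_ne_zero.2 k.factorial_ne_zero
    have h3 : (k : C) + 1 ≠ 0 := Nat.cast_add_one_ne_zero k
    rw [Nat.factorial_succ]
    push_cast
    field_simp
  let u : ℕ → R⸨X⸩ := fun l => ∑ k ∈ Finset.range (l + 1), HahnSeries.C (a k) * g ^ k
  have hu : ∀ l, u (l + 1) = u l + HahnSeries.C (a (l + 1)) * g ^ (l + 1) := fun l =>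
    Finset.sum_range_succ _ _
  have hu0 : u 0 = 1 := by
    simp [u, a]
  -- Only the last term of the truncated exponential violates `ϑu = qu`; the defect `q g^l / l!` is
  -- divisible by `t^{l+1}`, since `t` divides both `q` and `g`.
  have hθ : ∀ l, theta (u l) = q * (u l - HahnSeries.C (a l) * g ^ l) := by
    intro l
    induction l with
    | zero =>
      have h1 : HahnSeries.C (a 0) * g ^ 0 = u 0 :=
        (Finset.sum_range_one fun k => (HahnSeries.C (a k) : R⸨X⸩) * g ^ k).symm
      rw [h1, sub_self, mul_zero, hu0, ← map_one (HahnSeries.C : R →+* R⸨X⸩), theta_C]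
    | succ l ih =>
      have h2 : theta (HahnSeries.C (a (l + 1)) * g ^ (l + 1)) =
          q * (HahnSeries.C (a l) * g ^ l) := by
        rw [theta_C_mul, theta_pow_succ, ← mul_assoc, ← map_mul, ha, hg]
        ring
      rw [hu, theta_add, ih, h2]
      ring
  refine ⟨p₀, u, hp₀', fun l => ⟨?_, ?_, ?_⟩⟩
  · rw [hθ, ← hq, ← hg]
    have h1 : theta g * (u l - HahnSeries.C (a l) * g ^ l) - theta g * u l =
        -(HahnSeries.C (a l) * (g ^ l * theta g)) := by ring
    rw [h1, dvd_neg, pow_succ, map_mul]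
    refine Dvd.dvd.mul_left (mul_dvd_mul (hgpow l) ?_) _
    rw [hg]
    exact C_dvd_of_dvd_coeff hqt
  · have h1 : (HahnSeries.C t : R⸨X⸩) ∣ 1 - u l := by
      induction l with
      | zero => rw [hu0, sub_self]; exact dvd_zero _
      | succ l ih =>
        rw [hu, ← sub_sub]
        refine dvd_sub ih (Dvd.dvd.mul_left (hgt.trans (dvd_pow_self g (Nat.succ_ne_zero l))) _)
    -- Since `u l ≡ 1` modulo `t`, the truncated geometric series is an inverse modulo `t^{l+1}`.
    refine ⟨∑ i ∈ Finset.range (l + 1), (1 - u l) ^ i, ?_⟩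
    have h2 := mul_neg_geom_sum (1 - u l) (l + 1)
    rw [sub_sub_cancel] at h2
    rw [h2, sub_sub_cancel_left, dvd_neg, map_pow]
    exact pow_dvd_pow_of_dvd h1 _
  · rw [hu, add_sub_cancel_left]
    exact Dvd.dvd.mul_left (hgpow _) _

end Coefficients

/-! ### Diagonal gauge transformations -/

section Gauge

variable {A : Type*} [CommRing A] {E : Type*} [AddCommGroup E] [Module A⸨X⸩ E]

theorem HasTriangularMatrix.unitsSMul {ι : Type*} [Fintype ι] {D : Connection A E}
    {b : Module.Basis ι A⸨X⸩ E} {d : ι → A⸨X⸩} {N : ι → ι → A} (h : HasTriangularMatrix D b d N)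
    {w : ι → A⸨X⸩ˣ} (hw : ∀ i j, N i j ≠ 0 → w i = w j) {g : ι → A⸨X⸩}
    (hg : ∀ i, theta (w i : A⸨X⸩) = g i * w i) :
    HasTriangularMatrix D (b.unitsSMul w) (fun i => d i + g i) N := by
  intro j
  rw [Module.Basis.unitsSMul_apply, Units.smul_def, D.leibniz, h j, hg, smul_add, smul_smul,
    smul_smul, Finset.smul_sum, ← add_assoc, ← add_smul, mul_comm (w j : A⸨X⸩), ← add_mul,
    add_comm (g j)]
  congr 1
  refine Finset.sum_congr rfl fun i _ => ?_
  by_cases h0 : N i j = 0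
  · rw [h0, map_zero, zero_smul, zero_smul, smul_zero]
  · rw [Module.Basis.unitsSMul_apply, hw i j h0, Units.smul_def, smul_smul, smul_smul, mul_comm]

/-- Every series is gauge equivalent to a constant plus a polar part, and the constant may be
changed by an integer. -/
theorem exists_gauge [Algebra ℚ A] (f : A⸨X⸩) (k : ℤ) :
    ∃ (w : A⸨X⸩ˣ) (g p : A⸨X⸩), theta (w : A⸨X⸩) = g * w ∧ IsPolar p ∧
      f + g = HahnSeries.C (f.coeff 0 + k) + p := by
  let p : A⸨X⸩ := ⟨fun n => if n < 0 then f.coeff n else 0,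
    f.isPWO_support.mono fun n hn h0 => hn (by
    have h1 : f.coeff n = 0 := h0
    simp only [h1, ite_self])⟩
  have hp : ∀ n, p.coeff n = if n < 0 then f.coeff n else 0 := fun n => rfl
  let h : A⸨X⸩ := p + HahnSeries.C (f.coeff 0) - f
  have hh : ∀ n : ℤ, n ≤ 0 → h.coeff n = 0 := by
    intro n hn
    rw [HahnSeries.coeff_sub, HahnSeries.coeff_add, hp]
    obtain hn | rfl := lt_or_eq_of_le hn
    · rw [if_pos hn, HahnSeries.C_apply, HahnSeries.coeff_single_of_ne hn.ne, add_zero, sub_self]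
    · simp
  obtain ⟨u, hu⟩ := exists_theta_eq_mul h hh
  -- The factor `x^k` adds `k` to the diagonal entry, and `u` cancels its part of positive degree,
  -- as `h` is the negative of that part.
  refine ⟨xPow A k * u, HahnSeries.C (k : A) + h, p, ?_, ?_, ?_⟩
  · rw [Units.val_mul, theta_mul, hu, theta_xPow]
    ring
  · intro n hn
    rw [hp, if_neg (not_lt.2 hn)]
  · rw [map_add]
    show f + (_ + (p + HahnSeries.C (f.coeff 0) - f)) = _
    ring

/-- The endomorphism which is diagonal in the basis `b`. -/
def diagMap {ι : Type*} [Fintype ι] (b : Module.Basis ι A⸨X⸩ E) (w : ι → A⸨X⸩) :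
    E →ₗ[A⸨X⸩] E :=
  b.constr ℤ fun i => w i • b i

theorem diagMap_basis {ι : Type*} [Fintype ι] (b : Module.Basis ι A⸨X⸩ E) (w : ι → A⸨X⸩) (i : ι) :
    diagMap b w (b i) = w i • b i :=
  b.constr_basis ℤ _ i

theorem repr_diagMap {ι : Type*} [Fintype ι] (b : Module.Basis ι A⸨X⸩ E) (w : ι → A⸨X⸩) (v : E)
    (i : ι) : b.repr (diagMap b w v) i = w i * b.repr v i := by
  have h1 : diagMap b w v = ∑ j, (w j * b.repr v j) • b j := by
    conv_lhs => rw [← b.sum_repr v, map_sum]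
    refine Finset.sum_congr rfl fun j _ => ?_
    rw [map_smul, diagMap_basis, smul_smul, mul_comm]
  rw [h1, b.repr_sum_self]

theorem HasTriangularMatrix.subLinear_diagMap {ι : Type*} [Fintype ι] {D : Connection A E}
    {b : Module.Basis ι A⸨X⸩ E} {d : ι → A⸨X⸩} {N : ι → ι → A} (h : HasTriangularMatrix D b d N)
    (w : ι → A⸨X⸩) :
    HasTriangularMatrix (D.subLinear (diagMap b w)) b (fun i => d i - w i) N := by
  intro j
  rw [Connection.subLinear_apply, h j, diagMap_basis, sub_smul]
  abel

end Gauge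

/-! ### Projections to `E|_ℓ` twisted by a diagonal gauge -/

section Reduction

variable {C R : Type*} [Field C] [CommRing R] [Algebra C R] {t : R}
  {E : Type*} [AddCommGroup E] [Module R⸨X⸩ E]

theorem mem_tPowSubmodule_iff {ι : Type*} [Fintype ι] (b : Module.Basis ι R⸨X⸩ E) {l : ℕ} {v : E} :
    v ∈ tPowSubmodule t E l ↔ ∀ i, (HahnSeries.C (t ^ (l + 1)) : R⸨X⸩) ∣ b.repr v i := by
  constructor
  · rintro ⟨w, rfl⟩ i
    rw [LinearMap.lsmul_apply, map_smul, Finsupp.smul_apply, smul_eq_mul]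
    exact dvd_mul_right _ _
  · intro h
    choose f hf using h
    refine ⟨∑ i, f i • b i, ?_⟩
    rw [LinearMap.lsmul_apply, Finset.smul_sum]
    conv_rhs => rw [← b.sum_repr v]
    refine Finset.sum_congr rfl fun i _ => ?_
    rw [smul_smul, ← hf]

theorem Reduction.mk_eq_zero_iff {l : ℕ} {v : E} :
    Reduction.mk t E l v = 0 ↔ v ∈ tPowSubmodule t E l :=
  Submodule.Quotient.mk_eq_zero _

theorem Reduction.transition_mk (l : ℕ) (v : E) :
    Reduction.transition t E l (Reduction.mk t E (l + 1) v) = Reduction.mk t E l v := rfl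

theorem Reduction.mk_surjective (l : ℕ) : Function.Surjective (Reduction.mk t E l) :=
  Submodule.mkQ_surjective _

/-- The projection `E → E|_ℓ` after a diagonal change of basis. -/
def twistedMk {ι : Type*} [Fintype ι] (t : R) (b : Module.Basis ι R⸨X⸩ E) (l : ℕ)
    (u : ι → R⸨X⸩) : E →ₗ[R⸨X⸩] Reduction t E l :=
  (Reduction.mk t E l).comp (diagMap b u)

variable {ι : Type*} [Fintype ι] {b : Module.Basis ι R⸨X⸩ E} {l : ℕ} {u : ι → R⸨X⸩}

/-- Being invertible modulo `t^{l+1}`, the twist does not change the kernel `t^{l+1}E`. -/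
theorem twistedMk_eq_zero_iff
    (hu : ∀ i, ∃ s, (HahnSeries.C (t ^ (l + 1)) : R⸨X⸩) ∣ u i * s - 1) {v : E} :
    twistedMk t b l u v = 0 ↔ ∀ i, (HahnSeries.C (t ^ (l + 1)) : R⸨X⸩) ∣ b.repr v i := by
  rw [twistedMk, LinearMap.comp_apply, Reduction.mk_eq_zero_iff, mem_tPowSubmodule_iff b]
  refine forall_congr' fun i => ?_
  rw [repr_diagMap]
  refine ⟨fun h => ?_, fun h => Dvd.dvd.mul_left h _⟩
  obtain ⟨s, hs⟩ := hu i
  have h1 := dvd_sub (Dvd.dvd.mul_left h s) (Dvd.dvd.mul_left hs (b.repr v i))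
  convert h1 using 1
  ring

theorem twistedMk_surjective
    (hu : ∀ i, ∃ s, (HahnSeries.C (t ^ (l + 1)) : R⸨X⸩) ∣ u i * s - 1) :
    Function.Surjective (twistedMk t b l u) := by
  intro z
  obtain ⟨v, rfl⟩ := Reduction.mk_surjective l z
  choose s hs using hu
  refine ⟨diagMap b s v, ?_⟩
  rw [← sub_eq_zero]
  rw [twistedMk, LinearMap.comp_apply, ← map_sub, Reduction.mk_eq_zero_iff, mem_tPowSubmodule_iff b]
  intro i
  rw [map_sub, Finsupp.sub_apply, repr_diagMap, repr_diagMap, ← mul_assoc, ← sub_one_mul]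
  exact Dvd.dvd.mul_right (hs i) _

theorem transition_twistedMk {u' : ι → R⸨X⸩}
    (hu : ∀ i, (HahnSeries.C (t ^ (l + 1)) : R⸨X⸩) ∣ u' i - u i) (v : E) :
    Reduction.transition t E l (twistedMk t b (l + 1) u' v) = twistedMk t b l u v := by
  rw [← sub_eq_zero, twistedMk, twistedMk, LinearMap.comp_apply, LinearMap.comp_apply,
    Reduction.transition_mk, ← map_sub, Reduction.mk_eq_zero_iff, mem_tPowSubmodule_iff b]
  intro i
  rw [map_sub, Finsupp.sub_apply, repr_diagMap, repr_diagMap, ← sub_mul]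
  exact Dvd.dvd.mul_right (hu i) _

theorem twistedMk_const_smul (f : C⸨X⸩) (v : E) :
    twistedMk t b l u (coeffMap C R f • v) = f • twistedMk t b l u v := by
  rw [twistedMk, LinearMap.comp_apply, LinearMap.comp_apply, map_smul]
  rfl

/-- The twist satisfies `ϑu = gu` modulo `t^{l+1}`, so differentiating it supplies the difference
`g` of the diagonals. It commutes with the off-diagonal part because it is constant along `N`. -/
theorem reduce_twistedMk {D D' : Connection R E} {d g : ι → R⸨X⸩} {N : ι → ι → R}
    (hD : HasTriangularMatrix D b d N) (hD' : HasTriangularMatrix D' b (fun i => d i + g i) N)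
    (hN : ∀ i j, N i j ≠ 0 → u i = u j)
    (hu : ∀ i, (HahnSeries.C (t ^ (l + 1)) : R⸨X⸩) ∣ theta (u i) - g i * u i) (v : E) :
    D.reduce C t l (twistedMk t b l u v) = twistedMk t b l u (D' v) := by
  rw [← sub_eq_zero, twistedMk, LinearMap.comp_apply, LinearMap.comp_apply, Connection.reduce_mk,
    ← map_sub, Reduction.mk_eq_zero_iff, mem_tPowSubmodule_iff b]
  intro i
  have h1 : ∑ j, HahnSeries.C (N i j) * (u j * b.repr v j) =
      u i * ∑ j, HahnSeries.C (N i j) * b.repr v j := by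
    rw [Finset.mul_sum]
    refine Finset.sum_congr rfl fun j _ => ?_
    by_cases h0 : N i j = 0
    · rw [h0, map_zero, zero_mul, zero_mul, mul_zero]
    · rw [hN i j h0]
      ring
  rw [map_sub, Finsupp.sub_apply, repr_diagMap, hD.repr_apply, hD'.repr_apply]
  simp only [repr_diagMap]
  rw [h1, theta_mul]
  have h2 := Dvd.dvd.mul_right (hu i) (b.repr v i)
  convert h2 using 1
  ring

end Reduction

/-! ### `E / t^l E` as a vector space over `C((x))` -/

section Level

variable {C R : Type*} [Field C] [CommRing R] [Algebra C R] {t : R}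
  {E : Type*} [AddCommGroup E] [Module R⸨X⸩ E] {M : Type*} [AddCommGroup M] [Module C⸨X⸩ M]

/-- `φ : E → M` identifies the `C((x))`-module `M` with `E / t^l E`; coordinates in `E` are taken
with respect to the basis `b`. -/
structure IsReductionMap (t : R) {ι : Type*} [Fintype ι] (b : Module.Basis ι R⸨X⸩ E) (l : ℕ)
    (φ : E →+ M) : Prop where
  surjective : Function.Surjective φ
  map_smul : ∀ (f : C⸨X⸩) (v : E), φ (coeffMap C R f • v) = f • φ v
  eq_zero_iff : ∀ v, φ v = 0 ↔ ∀ i, (HahnSeries.C (t ^ l) : R⸨X⸩) ∣ b.repr v i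

variable {ι : Type*} [Fintype ι] {b : Module.Basis ι R⸨X⸩ E} {l : ℕ} {φ : E →+ M}

theorem IsReductionMap.eq_zero_of_dvd (h : IsReductionMap (C := C) t b l φ) {f : R⸨X⸩}
    (hf : (HahnSeries.C (t ^ l) : R⸨X⸩) ∣ f) (v : E) : φ (f • v) = 0 := by
  rw [h.eq_zero_iff]
  intro i
  rw [_root_.map_smul, Finsupp.smul_apply, smul_eq_mul]
  exact Dvd.dvd.mul_right hf _

/-- Modulo `t^l` a series over `R` is a polynomial in `t` with coefficients in `C((x))`. This
translates the action of `R((x))` into that of `C((x))`. -/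
theorem IsReductionMap.expand (h : IsReductionMap (C := C) t b l φ) (e : R ≃ₐ[C] PowerSeries C)
    (ht : e t = PowerSeries.X) (f : R⸨X⸩) (v : E) :
    φ (f • v) = ∑ k : Fin l, tCoeffSeries e k f • φ ((HahnSeries.C (t ^ (k : ℕ)) : R⸨X⸩) • v) := by
  have h1 := h.eq_zero_of_dvd (C_pow_dvd_sub_sum e ht l f) v
  rw [sub_smul, map_sub, sub_eq_zero] at h1
  rw [h1, Finset.sum_smul, map_sum]
  refine Finset.sum_congr rfl fun k _ => ?_
  rw [mul_smul, h.map_smul]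

theorem IsReductionMap.linearIndependent (h : IsReductionMap (C := C) t b l φ)
    (e : R ≃ₐ[C] PowerSeries C) (ht : e t = PowerSeries.X) :
    LinearIndependent C⸨X⸩
      (fun y : ι × Fin l => φ ((HahnSeries.C (t ^ (y.2 : ℕ)) : R⸨X⸩) • b y.1)) := by
  rw [Fintype.linearIndependent_iff]
  intro g hg
  have h1 : φ (∑ i, (∑ k, coeffMap C R (g (i, k)) * HahnSeries.C (t ^ (k : ℕ))) • b i) = 0 := by
    rw [← hg, map_sum, Fintype.sum_prod_type]
    refine Finset.sum_congr rfl fun i _ => ?_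
    rw [Finset.sum_smul, map_sum]
    refine Finset.sum_congr rfl fun k _ => ?_
    rw [mul_smul, h.map_smul]
  rw [h.eq_zero_iff, b.repr_sum_self] at h1
  rintro ⟨i, k⟩
  exact eq_zero_of_C_pow_dvd_sum e ht (h1 i) k

theorem IsReductionMap.span_eq_top (h : IsReductionMap (C := C) t b l φ)
    (e : R ≃ₐ[C] PowerSeries C) (ht : e t = PowerSeries.X) :
    ⊤ ≤ Submodule.span C⸨X⸩
      (Set.range fun y : ι × Fin l => φ ((HahnSeries.C (t ^ (y.2 : ℕ)) : R⸨X⸩) • b y.1)) := by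
  intro v _
  obtain ⟨w, rfl⟩ := h.surjective v
  rw [← b.sum_repr w, map_sum]
  refine Submodule.sum_mem _ fun i _ => ?_
  rw [h.expand e ht]
  exact Submodule.sum_mem _ fun k _ => Submodule.smul_mem _ _ (Submodule.subset_span ⟨(i, k), rfl⟩)

theorem IsReductionMap.finrank_eq (h : IsReductionMap (C := C) t b l φ)
    (e : R ≃ₐ[C] PowerSeries C) (ht : e t = PowerSeries.X) :
    Module.finrank C⸨X⸩ M = Fintype.card ι * l := by
  rw [Module.finrank_eq_card_basis
    (Module.Basis.mk (h.linearIndependent e ht) (h.span_eq_top e ht)), Fintype.card_prod,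
    Fintype.card_fin]

end Level

/-! ### The finite-dimensional `C`-space attached to one string over `R` -/

section Block

variable {C R : Type*} [Field C] [CommRing R] {E : Type*} [AddCommGroup E] [Module R⸨X⸩ E]
  {M : Type*} [AddCommGroup M] {κ : Type*} {r : κ → ℕ}

/-- The `C`-subspace of `M` which corresponds to one Jordan string over `R`. -/
def blockSubspace (C : Type*) [Field C] [Module C M] (b : Module.Basis (Σ i, Fin (r i)) R⸨X⸩ E)
    (φ : E →+ M) (i : κ) : Submodule C M :=
  Submodule.span C (Set.range fun y : R × Fin (r i) => φ ((HahnSeries.C y.1 : R⸨X⸩) • b ⟨i, y.2⟩))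

theorem mem_blockSubspace [Module C M]
    {b : Module.Basis (Σ i, Fin (r i)) R⸨X⸩ E} {φ : E →+ M} (a : R) (i : κ) (j : Fin (r i)) :
    φ ((HahnSeries.C a : R⸨X⸩) • b ⟨i, j⟩) ∈ blockSubspace C b φ i :=
  Submodule.subset_span ⟨(a, j), rfl⟩

variable [Algebra C R] [Module C⸨X⸩ M] [Fintype κ] {b : Module.Basis (Σ i, Fin (r i)) R⸨X⸩ E}
  {l : ℕ} {φ : E →+ M} {t : R}

/-- The action of the connection on the generators of a block. -/
theorem sub_smul_block {δ : ∀ i, Fin (r i) → Bool} {D : Connection R E} {c : κ → R}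
    (hD : HasTriangularMatrix D b (fun x => HahnSeries.C (c x.1)) (chainMatrix R δ))
    {D' : Connection C M} (hφD : ∀ v, D' (φ v) = φ (D v))
    (hφ : ∀ (f : C⸨X⸩) (v : E), φ (coeffMap C R f • v) = f • φ v)
    (γ : C) (a : R) (x : Σ i, Fin (r i)) :
    D' (φ ((HahnSeries.C a : R⸨X⸩) • b x)) -
        (HahnSeries.C γ : C⸨X⸩) • φ ((HahnSeries.C a : R⸨X⸩) • b x) =
      φ ((HahnSeries.C ((c x.1 - algebraMap C R γ) * a) : R⸨X⸩) • b x) +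
        (chainNext δ x).elim 0 fun y => φ ((HahnSeries.C a : R⸨X⸩) • b y) := by
  rw [hφD, D.map_const_smul, ← hφ, coeffMap_C, ← map_sub, hD, sum_chainMatrix_smul, smul_add,
    smul_smul, smul_smul, add_sub_right_comm, ← sub_smul, ← map_mul, ← map_mul, ← map_sub, map_add]
  congr 1
  · congr 3
    ring
  · cases chainNext δ x with
    | none => rw [Option.elim_none, Option.elim_none, smul_zero, map_zero]
    | some y => rfl

variable [Module C M] [IsScalarTower C C⸨X⸩ M]

theorem IsReductionMap.blockSubspace_eq (h : IsReductionMap (C := C) t b l φ)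
    (e : R ≃ₐ[C] PowerSeries C) (ht : e t = PowerSeries.X) (i : κ) :
    blockSubspace C b φ i = Submodule.span C (Set.range fun y : Fin l × Fin (r i) =>
      φ ((HahnSeries.C (t ^ (y.1 : ℕ)) : R⸨X⸩) • b ⟨i, y.2⟩)) := by
  apply le_antisymm
  · refine Submodule.span_le.2 ?_
    rintro _ ⟨⟨a, j⟩, rfl⟩
    have h1 : ∀ k : ℕ, tCoeffSeries e k (HahnSeries.C a : R⸨X⸩) = HahnSeries.C (tCoeff e k a) := by
      intro k
      ext n
      rw [tCoeffSeries_coeff]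
      by_cases hn : n = 0
      · simp [hn]
      · rw [HahnSeries.C_apply, HahnSeries.C_apply, HahnSeries.coeff_single_of_ne hn,
          HahnSeries.coeff_single_of_ne hn, map_zero]
    simp only [SetLike.mem_coe]
    rw [h.expand e ht]
    refine Submodule.sum_mem _ fun k _ => ?_
    rw [h1, C_smul_eq]
    exact Submodule.smul_mem _ _ (Submodule.subset_span ⟨(k, j), rfl⟩)
  · refine Submodule.span_le.2 ?_
    rintro _ ⟨⟨k, j⟩, rfl⟩
    exact mem_blockSubspace _ _ _

theorem IsReductionMap.finiteDimensional_blockSubspace (h : IsReductionMap (C := C) t b l φ)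
    (e : R ≃ₐ[C] PowerSeries C) (ht : e t = PowerSeries.X) (i : κ) :
    FiniteDimensional C (blockSubspace C b φ i) := by
  rw [h.blockSubspace_eq e ht]
  exact FiniteDimensional.span_of_finite C (Set.finite_range _)

theorem IsReductionMap.finrank_blockSubspace_le (h : IsReductionMap (C := C) t b l φ)
    (e : R ≃ₐ[C] PowerSeries C) (ht : e t = PowerSeries.X) (i : κ) :
    Module.finrank C (blockSubspace C b φ i) ≤ r i * l := by
  rw [h.blockSubspace_eq e ht]
  refine (finrank_range_le_card _).trans ?_
  rw [Fintype.card_prod, Fintype.card_fin, Fintype.card_fin, mul_comm]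

theorem blockSubspace_stable {δ : ∀ i, Fin (r i) → Bool} {D : Connection R E} {c : κ → R}
    (hD : HasTriangularMatrix D b (fun x => HahnSeries.C (c x.1)) (chainMatrix R δ))
    {D' : Connection C M} (hφD : ∀ v, D' (φ v) = φ (D v))
    (hφ : ∀ (f : C⸨X⸩) (v : E), φ (coeffMap C R f • v) = f • φ v) (γ : C) (i : κ) :
    ∀ v ∈ blockSubspace C b φ i, D' v - (HahnSeries.C γ : C⸨X⸩) • v ∈ blockSubspace C b φ i := by
  intro v hv
  have key : blockSubspace C b φ i ≤ (blockSubspace C b φ i).comap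
      (D'.toLinear - algebraMap C (Module.End C M) γ) := by
    refine Submodule.span_le.2 ?_
    rintro _ ⟨⟨a, j⟩, rfl⟩
    simp only [SetLike.mem_coe, Submodule.mem_comap, LinearMap.sub_apply,
      Module.algebraMap_end_apply, Connection.toLinear_apply]
    rw [← C_smul_eq, sub_smul_block hD hφD hφ]
    refine Submodule.add_mem _ (mem_blockSubspace _ _ _) ?_
    cases hy : chainNext δ (⟨i, j⟩ : Σ i, Fin (r i)) with
    | none => exact Submodule.zero_mem _
    | some y =>
      obtain ⟨i', j'⟩ := y
      have h1 : i' = i := (chainNext_eq_some hy).1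
      subst h1
      exact mem_blockSubspace _ _ _
  rw [C_smul_eq]
  exact key hv

/-- `D'` minus the reduction of `cᵢ` is a sum of two commuting moves: multiplication by a multiple
of `t`, and a step along the string. Modulo `t^l`, and on a finite string, both end. -/
theorem IsReductionMap.blockSubspace_le_maxGenEigenspace (h : IsReductionMap (C := C) t b l φ)
    (e : R ≃ₐ[C] PowerSeries C) (ht : e t = PowerSeries.X)
    {δ : ∀ i, Fin (r i) → Bool} {D : Connection R E} {c : κ → R}
    (hD : HasTriangularMatrix D b (fun x => HahnSeries.C (c x.1)) (chainMatrix R δ))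
    {D' : Connection C M} (hφD : ∀ v, D' (φ v) = φ (D v)) (i : κ) :
    blockSubspace C b φ i ≤ D'.toLinear.maxGenEigenspace (tCoeff e 0 (c i)) := by
  set G := D'.toLinear.maxGenEigenspace (tCoeff e 0 (c i)) with hG
  have hstep : ∀ v, D' v - (HahnSeries.C (tCoeff e 0 (c i)) : C⸨X⸩) • v ∈ G → v ∈ G := by
    intro v hv
    rw [C_smul_eq, hG, Module.End.mem_maxGenEigenspace] at hv
    obtain ⟨q, hq⟩ := hv
    rw [hG, Module.End.mem_maxGenEigenspace]
    refine ⟨q + 1, ?_⟩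
    rw [pow_succ, Module.End.mul_apply]
    exact hq
  -- Outer induction on the number `m` of factors `t` still missing for `a b` to vanish, inner
  -- induction from the end of the string.
  have key : ∀ m : ℕ, m ≤ l → ∀ j : Fin (r i), ∀ a : R, t ^ (l - m) ∣ a →
      φ ((HahnSeries.C a : R⸨X⸩) • b ⟨i, j⟩) ∈ G := by
    intro m
    induction m with
    | zero =>
      rintro - j a ⟨a', rfl⟩
      rw [h.eq_zero_of_dvd (by rw [map_mul]; exact dvd_mul_right _ _)]
      exact Submodule.zero_mem _
    | succ m ih =>
      intro hm
      refine induction_of_lt_height (ι := Fin (r i)) (fun j => (j : ℕ)) fun j ihj a ha => hstep _ ?_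
      rw [sub_smul_block hD hφD h.map_smul]
      refine Submodule.add_mem _ (ih (by omega) j _ ?_) ?_
      · have h1 : l - m = 1 + (l - (m + 1)) := by omega
        rw [h1, pow_add, pow_one]
        exact mul_dvd_mul (dvd_sub_algebraMap_tCoeff e ht _) ha
      · cases hy : chainNext δ (⟨i, j⟩ : Σ i, Fin (r i)) with
        | none => exact Submodule.zero_mem _
        | some y =>
          obtain ⟨i', j'⟩ := y
          have h1 : i' = i := (chainNext_eq_some hy).1
          subst h1
          have h2 : (j' : ℕ) = j + 1 := (chainNext_eq_some hy).2.1
          exact ihj j' (by omega) a ha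
  refine Submodule.span_le.2 ?_
  rintro _ ⟨⟨a, j⟩, rfl⟩
  exact key l le_rfl j a (by rw [Nat.sub_self, pow_zero]; exact one_dvd a)

/-- A basis of Jordan strings over `C((x))` for the reduction of a connection with a Jordan basis
over `R((x))`. -/
theorem IsReductionMap.exists_chain_basis (h : IsReductionMap (C := C) t b l φ)
    (e : R ≃ₐ[C] PowerSeries C) (ht : e t = PowerSeries.X)
    {δ : ∀ i, Fin (r i) → Bool} {D : Connection R E} {c : κ → R}
    (hD : HasTriangularMatrix D b (fun x => HahnSeries.C (c x.1)) (chainMatrix R δ))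
    {D' : Connection C M} (hφD : ∀ v, D' (φ v) = φ (D v)) :
    ∃ (d : κ → ℕ) (s : (Σ i, Fin (d i)) → ℕ) (b' : Module.Basis (Σ a, Fin (s a)) C⸨X⸩ M),
      (∀ x, b' x ∈ blockSubspace C b φ x.1.1) ∧
      (∀ i, blockSubspace C b φ i ≤ Submodule.span C (Set.range b')) ∧
      HasTriangularMatrix D' b' (fun x => HahnSeries.C (tCoeff e 0 (c x.1.1)))
        (chainMatrix C fun _ _ => true) := by
  have := h.finiteDimensional_blockSubspace e ht
  refine FormalConnection.exists_chain_basis D' (fun i => tCoeff e 0 (c i)) (blockSubspace C b φ)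
    (fun i => blockSubspace_stable hD hφD h.map_smul _ i)
    (h.blockSubspace_le_maxGenEigenspace e ht hD hφD) ?_ ?_
  · refine (h.span_eq_top e ht).trans (Submodule.span_mono ?_)
    rintro _ ⟨⟨⟨i, j⟩, k⟩, rfl⟩
    exact Set.mem_iUnion.2 ⟨i, mem_blockSubspace _ _ _⟩
  -- The rank of `M` is `l ∑ rᵢ`, and the block of the `i`-th string has dimension at most `rᵢ l`.
  · rw [h.finrank_eq e ht, Fintype.card_sigma, Finset.sum_mul]
    refine Finset.sum_le_sum fun i _ => ?_
    rw [Fintype.card_fin]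
    exact h.finrank_blockSubspace_le e ht i

end Block

/-! ### Regular singular part and lattice of one reduction -/

section Level

variable {C R : Type*} [Field C] [CommRing R] [Algebra C R] {t : R}
  {E : Type*} [AddCommGroup E] [Module R⸨X⸩ E] {M : Type*} [AddCommGroup M] [Module C⸨X⸩ M]
  {κ : Type*} [Fintype κ] {r : κ → ℕ} {b : Module.Basis (Σ i, Fin (r i)) R⸨X⸩ E} {l : ℕ}
  {φ : E →+ M}

/-- The regular singular part and the Deligne-Manin lattice of a reduction. -/
theorem IsReductionMap.regularSingularPart_and_lattice [IsAlgClosed C] [CharZero C]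
    (h : IsReductionMap (C := C) t b l φ)
    (e : R ≃ₐ[C] PowerSeries C) (ht : e t = PowerSeries.X) {τ : Set C}
    (hτ : ∀ a ∈ τ, ∀ a' ∈ τ, (∃ k : ℤ, a - a' = k) → a = a')
    {δ : ∀ i, Fin (r i) → Bool} {D : Connection R E} {c : κ → R}
    (hD : HasTriangularMatrix D b (fun x => HahnSeries.C (c x.1)) (chainMatrix R δ))
    (hc : ∀ i, tCoeff e 0 (c i) ∈ τ) {D₁ D' : Connection C M}
    (hφD : ∀ v, D' (φ v) = φ (D v)) {p : κ → C⸨X⸩} (hp : ∀ i, IsPolar (p i))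
    (hD₁ : ∀ x (a : R), D₁ (φ ((HahnSeries.C a : R⸨X⸩) • b x)) =
      D' (φ ((HahnSeries.C a : R⸨X⸩) • b x)) + p x.1 • φ ((HahnSeries.C a : R⸨X⸩) • b x)) :
    IsRegularSingularPart D₁ D' ∧
    ∃ L₀ : Submodule (powerSeriesSubring C) M, (∀ L, IsDeligneManinLattice τ D' L ↔ L = L₀) ∧
      ∀ v, v ∈ L₀ ↔ ∃ w ∈ Submodule.span (powerSeriesSubring R) (Set.range b), φ w = v := by
  let _ : Module C M := Module.compHom M (HahnSeries.C : C →+* C⸨X⸩)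
  have : IsScalarTower C C⸨X⸩ M := ⟨fun a f v => by
    rw [← HahnSeries.C_mul_eq_smul, mul_smul]
    rfl⟩
  obtain ⟨d, s, b', hb'V, hVb', hD'⟩ := h.exists_chain_basis e ht hD hφD
  have hN : ∀ i j, chainMatrix C (fun (a : Σ i, Fin (d i)) (_ : Fin (s a)) => true) i j ≠ 0 →
      (j.2 : ℕ) < i.2 := fun i j hij => (chainMatrix_ne_zero hij).2
  -- On a whole block `D₁ - D'` is multiplication by the scalar `p i`, so a Jordan basis for `D'`
  -- that lies in the blocks also serves `D₁`.
  have hD₁V : ∀ i, ∀ v ∈ blockSubspace C b φ i, D₁ v = D' v + p i • v := by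
    intro i v hv
    refine Submodule.span_induction (p := fun v _ => D₁ v = D' v + p i • v) ?_ ?_ ?_ ?_ hv
    · rintro _ ⟨⟨a, j⟩, rfl⟩
      exact hD₁ ⟨i, j⟩ a
    · rw [map_zero, map_zero, smul_zero, add_zero]
    · intro v w _ _ hv hw
      rw [map_add, map_add, hv, hw, smul_add]
      abel
    · intro a v _ hv
      rw [← C_smul_eq, D₁.map_const_smul, D'.map_const_smul, hv, smul_add, smul_smul, smul_smul,
        mul_comm]
  have hC : ∀ x ∈ Submodule.span C (Set.range b'),
      x ∈ Submodule.span (powerSeriesSubring C) (Set.range b') := by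
    intro x hx
    refine Submodule.span_induction ?_ (Submodule.zero_mem _)
      (fun v w _ _ hv hw => Submodule.add_mem _ hv hw) (fun a v _ hv => ?_) hx
    · exact fun v hv => Submodule.subset_span hv
    · rw [← C_smul_eq]
      exact smul_mem_of_mem_powerSeriesSubring (C_mem_powerSeriesSubring a) hv
  refine ⟨isRegularSingularPart_of_chain b' (fun a => tCoeff e 0 (c a.1)) (fun a => p a.1)
    (fun a => hp _) (fun a a' => hτ _ (hc _) _ (hc _)) hD' ?_,
    Submodule.span (powerSeriesSubring C) (Set.range b'), fun L => ⟨fun hL => ?_, ?_⟩,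
    fun v => ⟨fun hv => ?_, ?_⟩⟩
  · intro x
    rw [hD₁V _ _ (hb'V x), hD' x, add_smul]
    abel
  · exact hL.eq_span hD' hN (fun x => hc _) hτ
  · rintro rfl
    exact isDeligneManinLattice_span hD' hN fun x => hc _
  · refine Submodule.span_induction (p := fun v _ => ∃ w ∈
      Submodule.span (powerSeriesSubring R) (Set.range b), φ w = v) ?_ ?_ ?_ ?_ hv
    · rintro _ ⟨x, rfl⟩
      refine Submodule.span_induction (p := fun v _ => ∃ w ∈
        Submodule.span (powerSeriesSubring R) (Set.range b), φ w = v) ?_ ?_ ?_ ?_ (hb'V x)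
      · rintro _ ⟨⟨a, j⟩, rfl⟩
        exact ⟨_, smul_mem_of_mem_powerSeriesSubring (C_mem_powerSeriesSubring a)
          (Submodule.subset_span ⟨_, rfl⟩), rfl⟩
      · exact ⟨0, Submodule.zero_mem _, map_zero φ⟩
      · rintro _ _ _ _ ⟨v, hv, rfl⟩ ⟨w, hw, rfl⟩
        exact ⟨v + w, Submodule.add_mem _ hv hw, map_add φ v w⟩
      · rintro a _ _ ⟨v, hv, rfl⟩
        refine ⟨_, smul_mem_of_mem_powerSeriesSubring
          (C_mem_powerSeriesSubring (algebraMap C R a)) hv, ?_⟩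
        rw [← coeffMap_C, h.map_smul, C_smul_eq]
    · exact ⟨0, Submodule.zero_mem _, map_zero φ⟩
    · rintro _ _ _ _ ⟨v, hv, rfl⟩ ⟨w, hw, rfl⟩
      exact ⟨v + w, Submodule.add_mem _ hv hw, map_add φ v w⟩
    · rintro f _ _ ⟨v, hv, rfl⟩
      refine ⟨coeffMap C R f • v, smul_mem_of_mem_powerSeriesSubring ?_ hv, h.map_smul f v⟩
      rw [mem_powerSeriesSubring_iff]
      intro n hn
      rw [coeffMap_coeff, mem_powerSeriesSubring_iff.1 f.2 n hn, map_zero]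
  · rintro ⟨w, hw, rfl⟩
    rw [← b.sum_repr w, map_sum]
    refine Submodule.sum_mem _ fun x _ => ?_
    -- The `t`-coefficients of a series in `R[[x]]` lie in `C[[x]]`, and each `φ(t^k b)` is a
    -- `C`-combination of `b'`.
    rw [h.expand e ht]
    refine Submodule.sum_mem _ fun k _ => smul_mem_of_mem_powerSeriesSubring ?_
      (hC _ (hVb' x.1 (mem_blockSubspace _ _ _)))
    rw [mem_powerSeriesSubring_iff]
    intro n hn
    rw [tCoeffSeries_coeff, (mem_span_powerSeriesSubring_iff b).1 hw x n hn, map_zero]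

end Level

/-! ### Normal form over `R((x))` and passage to the limit -/

section Main

variable {C R : Type*} [Field C] [CommRing R] [Algebra C R] {t : R}
  {E : Type*} [AddCommGroup E] [Module R⸨X⸩ E]

/-- A connection with a TLJ-form has a basis of Jordan strings with diagonal entries
`cᵢ + pᵢ`, where `pᵢ` is polar and `cᵢ` reduces to an element of `τ`. -/
theorem HasTLJForm.exists_chain_basis [CharZero C] (e : R ≃ₐ[C] PowerSeries C) {τ : Set C}
    (hτ : ∀ c : C, ∃ a ∈ τ, ∃ k : ℤ, c - a = (k : C)) {D : Connection R E} (hD : HasTLJForm D) :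
    ∃ (n : ℕ) (r : Fin n → ℕ) (δ : ∀ i, Fin (r i) → Bool)
      (b : Module.Basis (Σ i, Fin (r i)) R⸨X⸩ E) (c : Fin n → R) (p : Fin n → R⸨X⸩),
      (∀ i, IsPolar (p i)) ∧ (∀ i, tCoeff e 0 (c i) ∈ τ) ∧
      HasTriangularMatrix D b (fun x => HahnSeries.C (c x.1) + p x.1) (chainMatrix R δ) := by
  let _ : Algebra ℚ R := ((algebraMap C R).comp (algebraMap ℚ C)).toAlgebra
  obtain ⟨n, f, hdec, hb⟩ := hD
  choose r b δ hb using hb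
  have h1 := hdec.hasTriangularMatrix (d := fun x => f x.1) b hb
  -- The constant coefficient of `fᵢ` is shifted by `-kᵢ`, so that its reduction modulo `t` becomes
  -- the representative `aᵢ ∈ τ`.
  choose a ha k hk using fun i => hτ (tCoeff e 0 ((f i).coeff 0))
  choose w g p hw hp hfg using fun i => exists_gauge (f i) (-k i)
  have h2 := h1.unitsSMul (w := fun x => w x.1) (g := fun x => g x.1)
    (fun i j hij => by rw [(chainMatrix_ne_zero hij).1]) (fun x => hw x.1)
  simp only [hfg] at h2
  refine ⟨n, r, δ, _, fun i => (f i).coeff 0 + ((-k i : ℤ) : R), p, hp, fun i => ?_, h2⟩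
  have h3 : (tCoeff e 0) ((f i).coeff 0 + ((-k i : ℤ) : R)) = a i := by
    rw [map_add, tCoeff_zero_intCast, Int.cast_neg, ← hk]
    ring
  rw [h3]
  exact ha i

theorem limit_family_injective {ι : Type*} [Fintype ι] (e : R ≃ₐ[C] PowerSeries C)
    (ht : e t = PowerSeries.X) (b : Module.Basis ι R⸨X⸩ E) {v : E}
    (h : ∀ (l : ℕ) (i : ι), (HahnSeries.C (t ^ (l + 1)) : R⸨X⸩) ∣ b.repr v i) : v = 0 := by
  refine b.ext_elem fun i => ?_
  rw [map_zero, Finsupp.zero_apply]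
  ext n
  exact eq_zero_of_forall_pow_dvd e ht fun l => C_dvd_iff.1 (h l i) n

theorem exists_limit_vector {ι : Type*} [Fintype ι] (e : R ≃ₐ[C] PowerSeries C)
    (ht : e t = PowerSeries.X) (b : Module.Basis ι R⸨X⸩ E) (w : ℕ → E)
    (hw : ∀ l, w l ∈ Submodule.span (powerSeriesSubring R) (Set.range b))
    (h : ∀ (l : ℕ) (i : ι),
      (HahnSeries.C (t ^ (l + 1)) : R⸨X⸩) ∣ b.repr (w (l + 1) - w l) i) :
    ∃ v : E, ∀ (l : ℕ) (i : ι), (HahnSeries.C (t ^ (l + 1)) : R⸨X⸩) ∣ b.repr (v - w l) i := by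
  choose g _ hg using fun i => exists_limit_series e ht (fun l => b.repr (w l) i)
    (fun l => mem_powerSeriesSubring_iff.2 ((mem_span_powerSeriesSubring_iff b).1 (hw l) i))
    (fun l => by
      have := h l i
      rwa [map_sub, Finsupp.sub_apply] at this)
  refine ⟨∑ i, g i • b i, fun l i => ?_⟩
  rw [map_sub, Finsupp.sub_apply, b.repr_sum_self]
  exact hg i l

/-- The transport of a connection along a linear isomorphism. -/
def Connection.transport {A : Type*} [CommRing A] {V W : Type*} [AddCommGroup V] [Module A⸨X⸩ V]
    [AddCommGroup W] [Module A⸨X⸩ W] (D : Connection A V) (ψ : V ≃ₗ[A⸨X⸩] W) : Connection A W where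
  toAddHom := (ψ.toAddEquiv.toAddMonoidHom.comp D.toAddHom).comp ψ.symm.toAddEquiv.toAddMonoidHom
  leibniz f w := by
    show ψ (D (ψ.symm (f • w))) = theta f • w + f • ψ (D (ψ.symm w))
    rw [map_smul, D.leibniz, map_add, map_smul, map_smul, LinearEquiv.apply_symm_apply]

theorem Connection.transport_apply {A : Type*} [CommRing A] {V W : Type*} [AddCommGroup V]
    [Module A⸨X⸩ V] [AddCommGroup W] [Module A⸨X⸩ W] (D : Connection A V) (ψ : V ≃ₗ[A⸨X⸩] W)
    (v : V) : D.transport ψ (ψ v) = ψ (D v) :=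
  congrArg (fun z => ψ (D z)) (ψ.symm_apply_apply v)

/-- If the lattices are the images of the lattice spanned by `b` under compatible maps
`φ l : E → E|_ℓ`, then these maps identify `E` with the module generated by the limit of the
lattices. -/
theorem exists_equiv_limitModule {ι : Type*} [Fintype ι] (e : R ≃ₐ[C] PowerSeries C)
    (ht : e t = PowerSeries.X) (b : Module.Basis ι R⸨X⸩ E)
    (φ : ∀ l : ℕ, E →ₗ[R⸨X⸩] Reduction t E l)
    (hφ : ∀ l v, φ l v = 0 ↔ ∀ i, (HahnSeries.C (t ^ (l + 1)) : R⸨X⸩) ∣ b.repr v i)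
    (hcomp : ∀ l v, Reduction.transition t E l (φ (l + 1) v) = φ l v)
    (L : ∀ l : ℕ, Submodule (powerSeriesSubring C) (Reduction t E l))
    (hL : ∀ l v, v ∈ L l ↔ ∃ w ∈ Submodule.span (powerSeriesSubring R) (Set.range b), φ l w = v) :
    ∃ ψ : E ≃ₗ[R⸨X⸩] limitModule L, ∀ v l, (ψ v : ∀ l : ℕ, Reduction t E l) l = φ l v := by
  have hb : ∀ i, LinearMap.pi φ (b i) ∈ limitLattice L := fun i l =>
    ⟨(hL l _).2 ⟨b i, Submodule.subset_span ⟨i, rfl⟩, rfl⟩, hcomp l _⟩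
  have hmem : ∀ v, LinearMap.pi φ v ∈ limitModule L := by
    intro v
    rw [← b.sum_repr v, map_sum]
    refine Submodule.sum_mem _ fun i _ => ?_
    rw [map_smul]
    exact Submodule.smul_mem _ _ (Submodule.subset_span (hb i))
  have hinj : Function.Injective (LinearMap.pi φ) := by
    rw [injective_iff_map_eq_zero]
    intro v hv
    exact limit_family_injective e ht b fun l => (hφ l v).1 (congrFun hv l)
  -- Lifts to the `R[[x]]`-span of the components of a compatible family form a `t`-adic Cauchy
  -- sequence; its limit maps to the family.
  have hsurj : limitModule L ≤ LinearMap.range (LinearMap.pi φ) := by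
    refine Submodule.span_le.2 fun v hv => ?_
    choose w hw hwv using fun l => (hL l _).1 (hv l).1
    obtain ⟨u, hu⟩ := exists_limit_vector e ht b w hw fun l => by
      rw [← hφ, map_sub, ← hcomp, hwv, hwv, (hv l).2, sub_self]
    refine ⟨u, funext fun l => ?_⟩
    have h1 := (hφ l _).2 (hu l)
    rw [map_sub, sub_eq_zero, hwv] at h1
    exact h1
  refine ⟨LinearEquiv.ofBijective ((LinearMap.pi φ).codRestrict _ hmem) ⟨?_, ?_⟩, fun v l => rfl⟩
  · exact fun v w hvw => hinj (congrArg Subtype.val hvw)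
  · rintro ⟨v, hv⟩
    obtain ⟨u, rfl⟩ := hsurj hv
    exact ⟨u, rfl⟩

/-- A connection with a TLJ-form, its regular singular part `D'`, and compatible maps
`φ l : E → E|_ℓ` with kernel `t^{ℓ+1} E` which transform `D'` into the regular singular part of the
reduction and a lattice of `E` into the Deligne-Manin lattice. -/
theorem HasTLJForm.exists_reduction_maps [IsAlgClosed C] [CharZero C] (e : R ≃ₐ[C] PowerSeries C)
    (ht : e t = PowerSeries.X) {τ : Set C} (hτ : ∀ c : C, ∃ a ∈ τ, ∃ k : ℤ, c - a = (k : C))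
    (hτu : ∀ a ∈ τ, ∀ a' ∈ τ, (∃ k : ℤ, a - a' = k) → a = a')
    {D : Connection R E} (hD : HasTLJForm D) :
    ∃ D' : Connection R E, IsRegularSingularPart D D' ∧
    ∃ (n : ℕ) (r : Fin n → ℕ) (b : Module.Basis (Σ i, Fin (r i)) R⸨X⸩ E)
      (φ : ∀ l : ℕ, E →ₗ[R⸨X⸩] Reduction t E l)
      (D₁ : ∀ l : ℕ, Connection C (Reduction t E l)),
      (∀ l v, φ l v = 0 ↔ ∀ x, (HahnSeries.C (t ^ (l + 1)) : R⸨X⸩) ∣ b.repr v x) ∧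
      (∀ l v, Reduction.transition t E l (φ (l + 1) v) = φ l v) ∧
      (∀ l v, D₁ l (φ l v) = φ l (D' v)) ∧
      ∀ l, IsRegularSingularPart (D.reduce C t l) (D₁ l) ∧
        ∃ L₀ : Submodule (powerSeriesSubring C) (Reduction t E l),
          (∀ L, IsDeligneManinLattice τ (D₁ l) L ↔ L = L₀) ∧
          ∀ v, v ∈ L₀ ↔ ∃ w ∈ Submodule.span (powerSeriesSubring R) (Set.range b), φ l w = v := by
  have := isDomain_of_algEquiv e
  obtain ⟨n, r, δ, b, c, p, hp, hc, hDb⟩ := hD.exists_chain_basis e hτ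
  choose p₀ u hp₀ hu using fun i => exists_truncated_exp e ht (hp i)
  have hD'b : HasTriangularMatrix (D.subLinear (diagMap b fun x => p x.1)) b
      (fun x => HahnSeries.C (c x.1)) (chainMatrix R δ) := by
    simpa only [add_sub_cancel_right] using hDb.subLinear_diagMap fun x => p x.1
  -- The part to be reduced subtracts `p₀` and not `p`: the reduction of `p` need not be
  -- diagonalizable over `C((x))`.
  have hD₀b := hDb.subLinear_diagMap fun x => coeffMap C R (p₀ x.1)
  have hφu : ∀ l (x : Σ i, Fin (r i)),
      ∃ s, (HahnSeries.C (t ^ (l + 1)) : R⸨X⸩) ∣ u x.1 l * s - 1 :=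
    fun l x => (hu x.1 l).2.1
  have hφD : ∀ l v, (D.subLinear (diagMap b fun x => coeffMap C R (p₀ x.1))).reduce C t l
      (twistedMk t b l (fun x => u x.1 l) v) =
        twistedMk t b l (fun x => u x.1 l) (D.subLinear (diagMap b fun x => p x.1) v) := by
    intro l v
    refine reduce_twistedMk (g := fun x => coeffMap C R (p₀ x.1) - p x.1) hD₀b ?_ ?_ ?_ v
    · convert hD'b using 2 with x
      ring
    · exact fun i j hij => by rw [(chainMatrix_ne_zero hij).1]
    · exact fun x => (hu x.1 l).1
  have hφ : ∀ l, IsReductionMap (C := C) t b (l + 1)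
      (twistedMk t b l fun x => u x.1 l).toAddMonoidHom := fun l =>
    ⟨twistedMk_surjective (hφu l), fun f v => twistedMk_const_smul f v,
      fun v => twistedMk_eq_zero_iff (hφu l)⟩
  have hpart : IsRegularSingularPart D (D.subLinear (diagMap b fun x => p x.1)) := by
    refine isRegularSingularPart_of_chain b c p hp ?_ hD'b hDb
    -- If `cᵢ - cᵢ'` is an integer `k`, the reductions, both in `τ`, coincide; so `k` vanishes
    -- modulo `t`, hence `k = 0`.
    rintro i i' ⟨k, hk⟩
    have h1 := hτu _ (hc i) _ (hc i') ⟨k, by rw [← map_sub, hk, tCoeff_zero_intCast]⟩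
    have h2 : tCoeff e 0 (c i - c i') = 0 := by rw [map_sub, h1, sub_self]
    rw [hk, tCoeff_zero_intCast, Int.cast_eq_zero] at h2
    rwa [h2, Int.cast_zero, sub_eq_zero] at hk
  have hP : ∀ l (x : Σ i, Fin (r i)) (a : R), D.reduce C t l
      (twistedMk t b l (fun x => u x.1 l) ((HahnSeries.C a : R⸨X⸩) • b x)) =
      (D.subLinear (diagMap b fun x => coeffMap C R (p₀ x.1))).reduce C t l
        (twistedMk t b l (fun x => u x.1 l) ((HahnSeries.C a : R⸨X⸩) • b x)) +
      p₀ x.1 • twistedMk t b l (fun x => u x.1 l) ((HahnSeries.C a : R⸨X⸩) • b x) := by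
    intro l x a
    rw [← twistedMk_const_smul, twistedMk, LinearMap.comp_apply, LinearMap.comp_apply,
      Connection.reduce_mk, Connection.reduce_mk, Connection.subLinear_apply, map_sub]
    simp only [map_smul, diagMap_basis, smul_smul]
    rw [mul_right_comm, mul_comm (coeffMap C R _) (HahnSeries.C a), sub_add_cancel]
  have hφ0 : ∀ l v, twistedMk t b l (fun x => u x.1 l) v = 0 ↔
      ∀ x, (HahnSeries.C (t ^ (l + 1)) : R⸨X⸩) ∣ b.repr v x := fun l v =>
    twistedMk_eq_zero_iff (hφu l)
  have hcomp : ∀ l v, Reduction.transition t E l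
      (twistedMk t b (l + 1) (fun x => u x.1 (l + 1)) v) =
        twistedMk t b l (fun x => u x.1 l) v := by
    intro l v
    have h1 : ∀ x : Σ i, Fin (r i),
        (HahnSeries.C (t ^ (l + 1)) : R⸨X⸩) ∣ u x.1 (l + 1) - u x.1 l := fun x => (hu x.1 l).2.2
    exact transition_twistedMk (b := b) (l := l) (u' := fun x : Σ i, Fin (r i) => u x.1 (l + 1))
      (u := fun x : Σ i, Fin (r i) => u x.1 l) h1 v
  have hlevel := fun l =>
    (hφ l).regularSingularPart_and_lattice e ht hτu hD'b hc (hφD l) hp₀ (hP l)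
  exact ⟨D.subLinear (diagMap b fun x => p x.1), hpart, n, r, b,
    fun l => twistedMk t b l fun x => u x.1 l,
    fun l => (D.subLinear (diagMap b fun x => coeffMap C R (p₀ x.1))).reduce C t l,
    hφ0, hcomp, hφD, hlevel⟩

end Main

end

end FormalConnection

/-! ### Proof of the theorem -/

open FormalConnection
theorem theorem4p15 {C R E : Type*} [Field C] [IsAlgClosed C] [CharZero C]
    [CommRing R] [Algebra C R] (e : R ≃ₐ[C] PowerSeries C) (t : R) (ht : e t = PowerSeries.X)
    (τ : Set C) (hτ : ∀ c : C, ∃! a : C, a ∈ τ ∧ ∃ k : ℤ, c - a = (k : C))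
    (hτ0 : τ ∩ Set.range (Int.cast : ℤ → C) = {0})
    [AddCommGroup E] [Module R⸨X⸩ E] [Module.Finite R⸨X⸩ E]
    (htors : ∀ (r : R) (v : E), r ≠ 0 → (HahnSeries.C r : R⸨X⸩) • v = 0 → v = 0)
    (D : Connection R E) (hD : HasTLJForm D) :
    (∃! Drs : Connection R E, IsRegularSingularPart D Drs) ∧
    (∀ l : ℕ, ∃! Dl : Connection C (Reduction t E l),
      IsRegularSingularPart (D.reduce C t l) Dl) ∧
    ∀ (Drs : Connection R E) (Dl : ∀ l : ℕ, Connection C (Reduction t E l)),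
      IsRegularSingularPart D Drs →
      (∀ l : ℕ, IsRegularSingularPart (D.reduce C t l) (Dl l)) →
      (∀ l : ℕ, ∃! L : Submodule (powerSeriesSubring C) (Reduction t E l),
        IsDeligneManinLattice τ (Dl l) L) ∧
      ∀ L : ∀ l : ℕ, Submodule (powerSeriesSubring C) (Reduction t E l),
        (∀ l : ℕ, IsDeligneManinLattice τ (Dl l) (L l)) →
        (∀ (l : ℕ) (r : R), ∀ v ∈ L l, (HahnSeries.C r : R⸨X⸩) • v ∈ L l) ∧
        (∀ l : ℕ, Reduction.transition t E l '' (L (l + 1) : Set (Reduction t E (l + 1))) =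
          (L l : Set (Reduction t E l))) ∧
        ∃ Ddot : Connection R (limitModule L),
          (∀ (v : limitModule L) (l : ℕ),
            (Ddot v : ∀ l : ℕ, Reduction t E l) l =
              Dl l ((v : ∀ l : ℕ, Reduction t E l) l)) ∧
          Drs.IsIsomorphic Ddot := by
  have hτu : ∀ a ∈ τ, ∀ a' ∈ τ, (∃ k : ℤ, a - a' = k) → a = a' := fun a ha a' ha' hk =>
    (hτ a).unique ⟨ha, 0, by simp⟩ ⟨ha', hk⟩
  have := isDomain_of_algEquiv e
  obtain ⟨D', hD', n, r, b, φ, D₁, hφ0, hcomp, hφD, hlevel⟩ :=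
    hD.exists_reduction_maps e ht (fun c => (hτ c).exists) hτu
  refine ⟨⟨D', hD', fun D'' h => h.unique hD'⟩,
    fun l => ⟨D₁ l, (hlevel l).1, fun D'' h => h.unique (hlevel l).1⟩, ?_⟩
  intro Drs Dl hDrs hDl
  -- By uniqueness all given data coincide with the constructed ones, and the remaining claims are
  -- read off from the maps `φ l`.
  obtain rfl : Drs = D' := hDrs.unique hD'
  obtain rfl : Dl = D₁ := funext fun l => (hDl l).unique (hlevel l).1
  choose L₀ hL₀ hmem using fun l => (hlevel l).2
  refine ⟨fun l => ⟨L₀ l, (hL₀ l _).2 rfl, fun L hL => (hL₀ l L).1 hL⟩, fun L hL => ?_⟩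
  obtain rfl : L = L₀ := funext fun l => (hL₀ l _).1 (hL l)
  obtain ⟨ψ, hψ⟩ := exists_equiv_limitModule e ht b φ hφ0 hcomp L hmem
  -- The connection on the limit module is the transport of the regular singular part; since the `φ
  -- l` intertwine, it is given by `Dl l` in every component.
  refine ⟨?_, ?_, Drs.transport ψ, ?_, ψ, fun v => (Drs.transport_apply ψ v).symm⟩
  · intro l s v hv
    obtain ⟨w, hw, rfl⟩ := (hmem l v).1 hv
    refine (hmem l _).2 ⟨_, smul_mem_of_mem_powerSeriesSubring (C_mem_powerSeriesSubring s) hw, ?_⟩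
    rw [map_smul]
  · intro l
    apply Set.Subset.antisymm
    · rintro _ ⟨v, hv, rfl⟩
      obtain ⟨w, hw, rfl⟩ := (hmem (l + 1) v).1 hv
      exact (hmem l _).2 ⟨w, hw, (hcomp l w).symm⟩
    · intro v hv
      obtain ⟨w, hw, rfl⟩ := (hmem l v).1 hv
      exact ⟨φ (l + 1) w, (hmem (l + 1) _).2 ⟨w, hw, rfl⟩, hcomp l w⟩
  · intro v l
    obtain ⟨w, rfl⟩ := ψ.surjective v
    rw [Drs.transport_apply, hψ, hψ, hφD]
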